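/- Let $m$ be Lebesgue measure on the unit circle $\mathbb T$, normalized by $m(\mathbb T)=1$. For a finite positive measure $\rho$ on $\mathbb T$ put \[ e_n(\rho)=\min_{q_0,\dots,q_{n-1}\in\mathbb C}\Bigl(\int_{\mathbb T}\bigl|q_0+q_1t+\dots+q_{n-1}t^{n-1}+t^n\bigr|^2\,d\rho(t)\Bigr)^{1/2}. \] Let $h\colon(0,\tfrac12]\to[0,\infty)$ be a non-increasing function, and let $\rho$ be the measure that is absolutely continuous with respect to $m$ with density $e^{-h(|\theta|)}$ at the point $e^{2\pi i\theta}$, $-\tfrac12<\theta\le\tfrac12$. Let $0<\delta\le\tfrac12$. For a function $g>0$ on $(0,\delta]$, write $h\simeq g$ if there are constants $c,C>0$ with $c\,g(\theta)\le h(\theta)\le C\,g(\theta)$ for all $\theta\in(0,\delta]$ (for $\delta=\tfrac12$ this is comparability on the whole domain of $h$); for a sequence $r_n>0$, write $|\log e_n(\rho)|\simeq r_n$ if there are constants $k,K>0$ with $k\,r_n\le|\log e_n(\rho)|\le K\,r_n$ for all $n\ge4$. Then: 1. if $h(\theta)\simeq \dfrac1{\theta\log(1/\theta)}$, then $|\log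 e_n(\rho)|\simeq\log\log n$; 2. if $p>-1$ and $h(\theta)\simeq\theta^{-1}\log^p(1/\theta)$, then $|\log e_n(\rho)|\simeq(\log n)^{p+1}$; 3. if $p>1$ and $h(\theta)\simeq\theta^{-p}$, then $|\log e_n(\rho)|\simeq n^{(p-1)/(p+1)}$; 4. if $p>0$ and $h(\theta)\simeq\exp(\theta^{-p})$, then $|\log e_n(\rho)|\simeq n(\log n)^{-2/p}$. In each case the constants $k,K$ depend only on $c$, $C$, $\delta$ and (in 2-4) on $p$, and not otherwise on $h$. -/

import Mathlib

/-- The unit circle with its Borel σ-algebra. -/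
noncomputable instance Circle.instMeasurableSpaceBorel : MeasurableSpace Circle := borel Circle

instance Circle.instBorelSpaceBorel : BorelSpace Circle := ⟨rfl⟩

/-- The Lebesgue measure `m` on the unit circle, normalized by `m(𝕋) = 1`:
the image of Lebesgue measure on `(-1/2, 1/2]` under `θ ↦ e^{2πiθ}`. -/
noncomputable def circleMeasure : MeasureTheory.Measure Circle :=
  MeasureTheory.Measure.map (fun θ : ℝ => Circle.exp (2 * Real.pi * θ))
    (MeasureTheory.volume.restrict (Set.Ioc (-1 / 2 : ℝ) (1 / 2)))

/-- `e_n(ρ)`: the distance in `L²(ρ)` from `t^n` to the polynomials of degree at most `n - 1`,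
i.e. the smallest `L²(ρ)`-norm of a monic polynomial of degree `n`. -/
noncomputable def szegoError (ρ : MeasureTheory.Measure Circle) (n : ℕ) : ℝ :=
  ⨅ q : Fin n → ℂ,
    Real.sqrt (∫ t : Circle, ‖(∑ k : Fin n, q k * (t : ℂ) ^ (k : ℕ)) + (t : ℂ) ^ n‖ ^ 2 ∂ρ)

/-- The absolutely continuous measure on the unit circle whose density with respect to `m` at
`t = e^{2πiθ}`, `-1/2 < θ ≤ 1/2`, is `e^{-h(|θ|)}`; here `θ = arg t / (2π)`. -/
noncomputable def deepZeroMeasure (h : ℝ → ℝ) : MeasureTheory.Measure Circle :=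
  circleMeasure.withDensity
    (fun t => ENNReal.ofReal (Real.exp (-h |Complex.arg (t : ℂ) / (2 * Real.pi)|)))

/-- `c g ≤ f ≤ C g` on `S`. -/
def ComparableOn {α : Type*} (S : Set α) (c C : ℝ) (f g : α → ℝ) : Prop :=
  ∀ x ∈ S, c * g x ≤ f x ∧ f x ≤ C * g x

/-- "If `h ≃ g`, then `|log e_n| ≃ r n` for `n ≥ 4`", for the measure with density `e^{-h(|θ|)}`,
where `h` ranges over the nonnegative nonincreasing functions on `(0, 1/2]`.
The relation `h ≃ g` is required on some interval `(0, δ]` with `0 < δ ≤ 1/2` (the case `δ = 1/2`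
is the whole domain), and the constants of the conclusion depend only on those of the
hypothesis, not on `h` itself. -/
def HasDeepZeroRate (g : ℝ → ℝ) (r : ℕ → ℝ) : Prop :=
  ∀ c C δ : ℝ, 0 < c → 0 < C → 0 < δ → δ ≤ 1 / 2 →
    ∃ k K : ℝ, 0 < k ∧ 0 < K ∧
      ∀ h : ℝ → ℝ, AntitoneOn h (Set.Ioc 0 (1 / 2)) → (∀ θ ∈ Set.Ioc (0 : ℝ) (1 / 2), 0 ≤ h θ) →
        ComparableOn (Set.Ioc 0 δ) c C h g →
          ComparableOn (Set.Ici 4) k K (fun n => |Real.log (szegoError (deepZeroMeasure h) n)|) r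

/-!
Write `w(θ) = e^{-h(|θ|)}`, so that `e_n²` is the minimum of `∫ |P|² w` over monic polynomials `P`
of degree `n`.

For the upper bound of `|log e_n|`, Jensen's inequality gives `∫ |P|² w ≥ exp (∫ log w)` for every
monic `P`, but `log w` need not be integrable. On `|θ| ≤ δ` the weight `w` is therefore replaced by
`|θ| e^{-h(δ) - 9(n+1)δ}`. A Remez-type inequality shows that this costs only a constant factor:
the symmetrization of `|P|²` is a polynomial in `cos 2πθ`, and the Chebyshev polynomials bound its
growth from one arc to another. The result is `|log e_n| ≲ δ h(δ) + n δ² + ∫_δ^{1/2} h`, where `δ`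
is chosen to balance the terms.

The lower bound needs good monic polynomials. If `h(δ) ≥ 10 n δ`, the monic Chebyshev polynomials
of the arc `|θ| ≥ δ` are exponentially small there, while on the complementary arc their growth is
beaten by `w`; this yields `|log e_n| ≳ n δ²`, which suffices for power and exponential growth. For
profiles close to `1 / θ`, let `W` be a combination of dyadic Fejér kernels with
`Re W ≤ h / 2 + O(1)`. Then `(1 + W / N)^N` is a polynomial version of `e^W`, its square is at most
a constant times `1 / w`, and dividing by its constant coefficient gives `|log e_n| ≥ W(0) - O(1)`,
where `W(0)` is a sum over about `log n` dyadic scales.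
-/

open MeasureTheory Polynomial Filter

/-! ### Points of the circle -/

/-- The point `e^{2πiθ}` of the unit circle. -/
noncomputable def circlePoint (θ : ℝ) : ℂ := (Circle.exp (2 * Real.pi * θ) : ℂ)

lemma circlePoint_eq_exp (θ : ℝ) :
    circlePoint θ = Complex.exp ((2 * Real.pi * θ : ℝ) * Complex.I) :=
  Circle.coe_exp _

@[fun_prop]
lemma continuous_circlePoint : Continuous circlePoint := by
  unfold circlePoint; fun_prop

@[simp]
lemma norm_circlePoint (θ : ℝ) : ‖circlePoint θ‖ = 1 :=
  Circle.norm_coe _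

lemma circlePoint_neg (θ : ℝ) : circlePoint (-θ) = (starRingEnd ℂ) (circlePoint θ) := by
  rw [circlePoint, mul_neg, Circle.exp_neg, Circle.coe_inv_eq_conj, circlePoint]

lemma circlePoint_add (a b : ℝ) : circlePoint (a + b) = circlePoint a * circlePoint b := by
  rw [circlePoint, mul_add, Circle.exp_add, Circle.coe_mul, circlePoint, circlePoint]

lemma circlePoint_pow (θ : ℝ) (k : ℕ) : circlePoint θ ^ k = circlePoint (k * θ) := by
  rw [circlePoint_eq_exp, circlePoint_eq_exp, ← Complex.exp_nat_mul]
  congr 1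
  push_cast
  ring

lemma circlePoint_re (θ : ℝ) : (circlePoint θ).re = Real.cos (2 * Real.pi * θ) := by
  rw [circlePoint_eq_exp, Complex.exp_ofReal_mul_I_re]

lemma circleMap_two_pi_mul (θ : ℝ) : circleMap 0 1 (2 * Real.pi * θ) = circlePoint θ := by
  rw [circlePoint_eq_exp]; simp [circleMap]

lemma periodic_circlePoint : Function.Periodic circlePoint 1 := fun θ => by
  rw [← circleMap_two_pi_mul, ← circleMap_two_pi_mul, mul_add, mul_one, periodic_circleMap]

lemma arg_circlePoint_div {θ : ℝ} (hθ : θ ∈ Set.Ioc (-1 / 2 : ℝ) (1 / 2)) :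
    Complex.arg (circlePoint θ) / (2 * Real.pi) = θ := by
  have := Real.pi_pos
  rw [circlePoint, Circle.arg_exp (by nlinarith [hθ.1]) (by nlinarith [hθ.2])]
  field_simp

lemma abs_arg_div_two_pi_le (z : ℂ) : |Complex.arg z / (2 * Real.pi)| ≤ 1 / 2 := by
  rw [abs_div, abs_of_pos Real.two_pi_pos, div_le_iff₀ Real.two_pi_pos]
  linarith [Complex.abs_arg_le_pi z]

/-! ### Integration against the measures with density `e^{-h}` -/

lemma intervalIntegral_neg_self {E : Type*} [NormedAddCommGroup E] [NormedSpace ℝ E] {f : ℝ → E}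
    {a : ℝ} (hf : IntervalIntegrable f volume 0 a)
    (hf' : IntervalIntegrable (fun θ => f (-θ)) volume 0 a) :
    ∫ θ in -a..a, f θ = ∫ θ in 0..a, (f θ + f (-θ)) := by
  have hneg : IntervalIntegrable f volume (-a) 0 := by
    simpa using ((IntervalIntegrable.iff_comp_neg (by finiteness)).1 hf').symm
  rw [← intervalIntegral.integral_add_adjacent_intervals hneg hf,
    intervalIntegral.integral_add hf hf', intervalIntegral.integral_comp_neg, neg_zero, add_comm]

/-- The functions `h` of the theorem: nonnegative and nonincreasing on `(0, 1/2]`. -/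
structure IsDeepProfile (h : ℝ → ℝ) : Prop where
  anti : AntitoneOn h (Set.Ioc 0 (1 / 2))
  nonneg : ∀ θ ∈ Set.Ioc (0 : ℝ) (1 / 2), 0 ≤ h θ

namespace IsDeepProfile

variable {h : ℝ → ℝ}

lemma exists_monotone_eqOn_exp_neg (hh : IsDeepProfile h) :
    ∃ G : ℝ → ℝ, Monotone G ∧ Set.EqOn (fun θ => Real.exp (-h θ)) G (Set.Ioc 0 (1 / 2)) := by
  refine MonotoneOn.exists_monotone_extension
    (fun x hx y hy hxy => Real.exp_le_exp.2 (neg_le_neg (hh.anti hx hy hxy))) ⟨0, ?_⟩ ⟨1, ?_⟩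
  · rintro _ ⟨θ, -, rfl⟩
    exact (Real.exp_pos _).le
  · rintro _ ⟨θ, hθ, rfl⟩
    exact Real.exp_le_one_iff.2 (neg_nonpos.2 (hh.nonneg θ hθ))

lemma measurable_density (hh : IsDeepProfile h) : Measurable fun t : Circle =>
    Real.exp (-h |Complex.arg (t : ℂ) / (2 * Real.pi)|) := by
  obtain ⟨G, hG, hGh⟩ := hh.exists_monotone_eqOn_exp_neg
  have hθ : Measurable fun t : Circle => |Complex.arg (t : ℂ) / (2 * Real.pi)| := by
    have : Continuous fun t : Circle => (t : ℂ) := by fun_prop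
    fun_prop
  have hite : Measurable fun x : ℝ => if x = 0 then Real.exp (-h 0) else G x :=
    Measurable.ite (measurableSet_singleton 0) measurable_const hG.measurable
  convert hite.comp hθ using 2 with t
  rw [Function.comp_apply]
  split_ifs with h0
  · rw [h0]
  · exact hGh ⟨lt_of_le_of_ne (abs_nonneg _) (Ne.symm h0), abs_arg_div_two_pi_le _⟩

lemma intervalIntegrable_mul_exp_neg (hh : IsDeepProfile h) {f : ℝ → ℝ} (hf : Continuous f) :
    IntervalIntegrable (fun θ => f θ * Real.exp (-h θ)) volume 0 (1 / 2) := by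
  obtain ⟨G, hG, hGh⟩ := hh.exists_monotone_eqOn_exp_neg
  refine (hG.intervalIntegrable.congr fun θ hθ => ?_).continuousOn_mul hf.continuousOn
  rw [Set.uIoc_of_le (by norm_num)] at hθ
  exact (hGh hθ).symm

lemma integral_deepZeroMeasure (hh : IsDeepProfile h) {F : ℂ → ℝ} (hF : Continuous F) :
    ∫ t : Circle, F t ∂(deepZeroMeasure h) =
      ∫ θ in 0..(1 / 2), (F (circlePoint θ) + F (circlePoint (-θ))) * Real.exp (-h θ) := by
  have hmap : ∫ t : Circle, F t ∂(deepZeroMeasure h) =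
      ∫ θ in -(1 / 2)..(1 / 2), F (circlePoint θ) * Real.exp (-h |θ|) := by
    have hexp : Measurable fun θ : ℝ => Circle.exp (2 * Real.pi * θ) := by fun_prop
    have hdens : Measurable fun t : Circle =>
        (ENNReal.ofReal (Real.exp (-h |Complex.arg (t : ℂ) / (2 * Real.pi)|))).toReal • F t :=
      hh.measurable_density.ennreal_ofReal.ennreal_toReal.smul
        (hF.measurable.comp (by fun_prop : Continuous fun t : Circle => (t : ℂ)).measurable)
    rw [deepZeroMeasure, integral_withDensity_eq_integral_toReal_smul
      hh.measurable_density.ennreal_ofReal (by simp), circleMeasure,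
      integral_map hexp.aemeasurable hdens.aestronglyMeasurable,
      intervalIntegral.integral_of_le (by norm_num), ← neg_div]
    refine setIntegral_congr_fun measurableSet_Ioc fun θ hθ => ?_
    simp only [smul_eq_mul]
    rw [ENNReal.toReal_ofReal (Real.exp_pos _).le, ← circlePoint, arg_circlePoint_div hθ, mul_comm]
  have hIntegrable : ∀ g : ℝ → ℝ, Continuous g →
      IntervalIntegrable (fun θ => g θ * Real.exp (-h |θ|)) volume 0 (1 / 2) := fun g hg =>
    (hh.intervalIntegrable_mul_exp_neg hg).congr fun θ hθ => by
      rw [Set.uIoc_of_le (by norm_num)] at hθ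
      rw [abs_of_pos hθ.1]
  rw [hmap, intervalIntegral_neg_self (hIntegrable _ (by fun_prop)) (by
    simpa only [abs_neg] using hIntegrable (fun θ => F (circlePoint (-θ))) (by fun_prop))]
  refine intervalIntegral.integral_congr fun θ hθ => ?_
  rw [Set.uIcc_of_le (by norm_num)] at hθ
  simp only [abs_neg, abs_of_nonneg hθ.1, add_mul]

end IsDeepProfile

/-! ### Extremal problems for monic polynomials -/

/-- The symmetrization `|P(e^{2πiθ})|² + |P(e^{-2πiθ})|²`, which lets all integrals over the circle
be written over `0 ≤ θ ≤ 1/2`. -/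
noncomputable def symmSq (P : ℂ[X]) (θ : ℝ) : ℝ :=
  ‖P.eval (circlePoint θ)‖ ^ 2 + ‖P.eval (circlePoint (-θ))‖ ^ 2

lemma symmSq_nonneg (P : ℂ[X]) (θ : ℝ) : 0 ≤ symmSq P θ := by unfold symmSq; positivity

@[fun_prop]
lemma continuous_symmSq (P : ℂ[X]) : Continuous (symmSq P) := by unfold symmSq; fun_prop

/-- The energy `∫ |P|² dρ` of a polynomial with respect to the measure of density `e^{-h(|θ|)}`. -/
noncomputable def energy (h : ℝ → ℝ) (P : ℂ[X]) : ℝ :=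
  ∫ θ in 0..(1 / 2), symmSq P θ * Real.exp (-h θ)

lemma energy_X_pow_mul (h : ℝ → ℝ) (P : ℂ[X]) (k : ℕ) : energy h (X ^ k * P) = energy h P := by
  simp [energy, symmSq]

namespace IsDeepProfile

variable {h : ℝ → ℝ}

lemma integral_norm_sq_eval (hh : IsDeepProfile h) (P : ℂ[X]) :
    ∫ t : Circle, ‖P.eval (t : ℂ)‖ ^ 2 ∂(deepZeroMeasure h) = energy h P :=
  hh.integral_deepZeroMeasure (F := fun z => ‖P.eval z‖ ^ 2) (by fun_prop)

lemma szegoError_le (hh : IsDeepProfile h) {P : ℂ[X]} (hP : P.Monic) :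
    szegoError (deepZeroMeasure h) P.natDegree ≤ Real.sqrt (energy h P) := by
  have hbdd : BddBelow (Set.range fun q : Fin P.natDegree → ℂ => Real.sqrt (∫ t : Circle,
      ‖(∑ k, q k * (t : ℂ) ^ (k : ℕ)) + (t : ℂ) ^ P.natDegree‖ ^ 2 ∂(deepZeroMeasure h))) :=
    ⟨0, Set.forall_mem_range.2 fun _ => Real.sqrt_nonneg _⟩
  refine (ciInf_le hbdd fun k => P.coeff k).trans (le_of_eq ?_)
  rw [← hh.integral_norm_sq_eval]
  congr 2
  ext t
  rw [eval_eq_sum_range, Finset.sum_range_succ, hP.coeff_natDegree, one_mul,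
    ← Fin.sum_univ_eq_sum_range (fun k => P.coeff k * (t : ℂ) ^ k)]

lemma le_szegoError (hh : IsDeepProfile h) {n : ℕ} {x : ℝ}
    (H : ∀ P : ℂ[X], P.Monic → P.natDegree = n → x ≤ Real.sqrt (energy h P)) :
    x ≤ szegoError (deepZeroMeasure h) n := by
  refine le_ciInf fun q => ?_
  have hdeg : (∑ k : Fin n, C (q k) * X ^ (k : ℕ) : ℂ[X]).degree < (n : WithBot ℕ) :=
    degree_sum_fin_lt q
  have hmonic : (X ^ n + ∑ k : Fin n, C (q k) * X ^ (k : ℕ)).Monic := monic_X_pow_add hdeg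
  have hnat : (X ^ n + ∑ k : Fin n, C (q k) * X ^ (k : ℕ)).natDegree = n :=
    natDegree_eq_of_degree_eq_some (by
      rw [degree_add_eq_left_of_degree_lt (by simpa using hdeg), degree_X_pow])
  refine (H _ hmonic hnat).trans (le_of_eq ?_)
  rw [← hh.integral_norm_sq_eval]
  congr 2
  ext t
  simp [eval_finsetSum, add_comm]

lemma szegoError_le_of_natDegree_le (hh : IsDeepProfile h) {P : ℂ[X]} (hP : P.Monic) {n : ℕ}
    (hn : P.natDegree ≤ n) : szegoError (deepZeroMeasure h) n ≤ Real.sqrt (energy h P) := by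
  have h1 := hh.szegoError_le ((monic_X_pow (R := ℂ) (n - P.natDegree)).mul hP)
  rwa [(monic_X_pow _).natDegree_mul hP, natDegree_X_pow, Nat.sub_add_cancel hn,
    energy_X_pow_mul] at h1

lemma szegoError_antitone (hh : IsDeepProfile h) : Antitone (szegoError (deepZeroMeasure h)) :=
  fun _ _ hmn => hh.le_szegoError fun _ hP hd =>
    hh.szegoError_le_of_natDegree_le hP (hd.trans_le hmn)

end IsDeepProfile

/-! ### Jensen's inequality for monic polynomials -/

lemma intervalIntegrable_log_norm_eval (P : ℂ[X]) (a b : ℝ) :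
    IntervalIntegrable (fun θ => Real.log ‖P.eval (circlePoint θ)‖) volume a b := by
  have hper : Function.Periodic (fun θ => Real.log ‖P.eval (circlePoint θ)‖) 1 := fun θ => by
    simp only [periodic_circlePoint θ]
  refine hper.intervalIntegrable (t := 0) one_ne_zero ?_ _ _
  convert (P.intervalIntegrable_mahlerMeasure).comp_mul_left (c := 2 * Real.pi) using 1
  · simp only [circleMap_two_pi_mul]
  · simp
  · field_simp
    simp

lemma intervalIntegrable_log_norm_eval_neg (P : ℂ[X]) (a b : ℝ) :
    IntervalIntegrable (fun θ => Real.log ‖P.eval (circlePoint (-θ))‖) volume a b := by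
  simpa using (IntervalIntegrable.iff_comp_neg (by finiteness)).1
    (intervalIntegrable_log_norm_eval P (-a) (-b))

lemma integral_log_norm_eval_eq_logMahlerMeasure (P : ℂ[X]) :
    ∫ θ in 0..(1 / 2), (Real.log ‖P.eval (circlePoint θ)‖ +
      Real.log ‖P.eval (circlePoint (-θ))‖) = P.logMahlerMeasure := by
  have hper : Function.Periodic (fun θ => Real.log ‖P.eval (circlePoint θ)‖) 1 := fun θ => by
    simp only [periodic_circlePoint θ]
  have hshift := hper.intervalIntegral_add_eq (-(1 / 2)) 0
  have hscale := intervalIntegral.integral_comp_mul_left (a := 0) (b := 1)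
    (fun x => Real.log ‖P.eval (circleMap 0 1 x)‖) (c := 2 * Real.pi) (by positivity)
  simp only [circleMap_two_pi_mul, mul_zero, mul_one] at hscale
  rw [← intervalIntegral_neg_self (intervalIntegrable_log_norm_eval P 0 (1 / 2))
      (intervalIntegrable_log_norm_eval_neg P 0 (1 / 2)),
    show (1 / 2 : ℝ) = -(1 / 2) + 1 by norm_num, show -(-(1 / 2) + 1) = (-(1 / 2) : ℝ) by norm_num,
    hshift, zero_add, hscale, logMahlerMeasure_def, Real.circleAverage_def]

lemma logMahlerMeasure_nonneg_of_monic {P : ℂ[X]} (hP : P.Monic) : 0 ≤ P.logMahlerMeasure := by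
  rw [logMahlerMeasure_eq_log_MahlerMeasure]
  exact Real.log_nonneg (one_le_mahlerMeasure_of_one_le_norm_leadingCoeff (by simp [hP]))

lemma ae_eval_circlePoint_ne_zero {P : ℂ[X]} (hP : P ≠ 0) :
    ∀ᵐ θ ∂(volume.restrict (Set.Ioc (0 : ℝ) (1 / 2))),
      P.eval (circlePoint θ) ≠ 0 ∧ P.eval (circlePoint (-θ)) ≠ 0 := by
  set S : Set ℝ := (fun z : ℂ => Complex.arg z / (2 * Real.pi)) '' {z | P.IsRoot z}
  have hS : S.Finite := (finite_setOfPred_isRoot hP).image _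
  have hmem : ∀ θ ∈ Set.Ioc (-1 / 2 : ℝ) (1 / 2), P.eval (circlePoint θ) = 0 → θ ∈ S :=
    fun θ hθ h0 => ⟨circlePoint θ, h0, arg_circlePoint_div hθ⟩
  rw [ae_restrict_iff' measurableSet_Ioc]
  filter_upwards [hS.countable.ae_notMem volume,
    (hS.preimage neg_injective.injOn).countable.ae_notMem volume,
    Measure.ae_ne volume (1 / 2 : ℝ)] with θ hpos hneg hne hθ
  have hlt : θ < 1 / 2 := lt_of_le_of_ne hθ.2 hne
  exact ⟨fun h0 => hpos (hmem θ ⟨by linarith [hθ.1], hθ.2⟩ h0),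
    fun h0 => hneg (hmem (-θ) ⟨by linarith, by linarith [hθ.1]⟩ h0)⟩

lemma exp_integral_le_integral_symmSq_mul_exp {P : ℂ[X]} (hP : P.Monic) {v : ℝ → ℝ}
    (hv : IntervalIntegrable v volume 0 (1 / 2))
    (hexp : IntervalIntegrable (fun θ => Real.exp (v θ)) volume 0 (1 / 2)) :
    Real.exp (2 * ∫ θ in 0..(1 / 2), v θ) ≤
      ∫ θ in 0..(1 / 2), symmSq P θ * Real.exp (v θ) := by
  have hle : (0 : ℝ) ≤ 1 / 2 := by norm_num
  set L : ℝ → ℝ := fun θ =>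
    Real.log ‖P.eval (circlePoint θ)‖ + Real.log ‖P.eval (circlePoint (-θ))‖
  set M : ℝ → ℝ := fun θ => ‖P.eval (circlePoint θ)‖ * ‖P.eval (circlePoint (-θ))‖ with hM
  have hLint : IntervalIntegrable L volume 0 (1 / 2) :=
    (intervalIntegrable_log_norm_eval P 0 (1 / 2)).add
      (intervalIntegrable_log_norm_eval_neg P 0 (1 / 2))
  have hMint : IntervalIntegrable (fun θ => M θ * Real.exp (v θ)) volume 0 (1 / 2) :=
    hexp.continuousOn_mul (by fun_prop)
  have hae : (fun θ => M θ * Real.exp (v θ)) =ᵐ[volume.restrict (Set.Ioc 0 (1 / 2))]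
      fun θ => Real.exp (L θ + v θ) := by
    filter_upwards [ae_eval_circlePoint_ne_zero hP.ne_zero] with θ hθ
    rw [Real.exp_add, Real.exp_add, Real.exp_log (norm_pos_iff.2 hθ.1),
      Real.exp_log (norm_pos_iff.2 hθ.2)]
  have hjensen := convexOn_exp.map_set_average_le (μ := volume) (t := Set.Ioc (0 : ℝ) (1 / 2))
    (f := fun θ => L θ + v θ) Real.continuous_exp.continuousOn isClosed_univ (by simp) (by simp)
    (ae_of_all _ fun _ => Set.mem_univ _) (hLint.add hv).1 (hMint.1.congr hae)
  simp only [setAverage_eq, Real.volume_real_Ioc_of_le hle, ← intervalIntegral.integral_of_le hle,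
    smul_eq_mul] at hjensen
  rw [intervalIntegral.integral_of_le hle (f := fun θ => Real.exp (L θ + v θ)),
    ← integral_congr_ae hae, ← intervalIntegral.integral_of_le hle,
    intervalIntegral.integral_add hLint hv] at hjensen
  have hL0 : 0 ≤ ∫ θ in 0..(1 / 2), L θ :=
    (logMahlerMeasure_nonneg_of_monic hP).trans_eq
      (integral_log_norm_eval_eq_logMahlerMeasure P).symm
  calc Real.exp (2 * ∫ θ in 0..(1 / 2), v θ)
      ≤ 2 * ∫ θ in 0..(1 / 2), M θ * Real.exp (v θ) := by
        refine (Real.exp_le_exp.2 ?_).trans (hjensen.trans_eq ?_) <;> norm_num; linarith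
    _ ≤ ∫ θ in 0..(1 / 2), symmSq P θ * Real.exp (v θ) := by
        rw [← intervalIntegral.integral_const_mul]
        refine intervalIntegral.integral_mono_on hle (hMint.const_mul 2)
          (hexp.continuousOn_mul (by fun_prop)) fun θ _ => ?_
        rw [← mul_assoc]
        refine mul_le_mul_of_nonneg_right ?_ (Real.exp_pos _).le
        simp only [hM, symmSq, ← mul_assoc]
        exact two_mul_le_add_sq _ _

/-! ### Growth of polynomials outside an interval -/

lemma one_add_sq_div_two_le_cosh (s : ℝ) : 1 + s ^ 2 / 2 ≤ Real.cosh s := by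
  have hsinh : (s / 2) ^ 2 ≤ Real.sinh (s / 2) ^ 2 := by
    rw [← sq_abs (s / 2), ← sq_abs (Real.sinh _), Real.abs_sinh]
    exact pow_le_pow_left₀ (abs_nonneg _) (Real.self_le_sinh_iff.2 (abs_nonneg _)) 2
  have hcosh := Real.cosh_two_mul (s / 2)
  rw [Real.cosh_sq, mul_div_cancel₀ s two_ne_zero] at hcosh
  linarith

lemma eval_chebyshev_T_le_exp {x s : ℝ} (hs : 0 ≤ s) (hx : 1 ≤ x) (hxs : x ≤ 1 + s ^ 2 / 2)
    (n : ℕ) : (Chebyshev.T ℝ n).eval x ≤ Real.exp (n * s) := by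
  have harcosh : Real.arcosh x ≤ s := by
    have : Real.cosh (Real.arcosh x) ≤ Real.cosh s := by
      rw [Real.cosh_arcosh hx]; exact hxs.trans (one_add_sq_div_two_le_cosh s)
    rwa [Real.cosh_le_cosh, abs_of_nonneg (Real.arcosh_nonneg hx), abs_of_nonneg hs] at this
  rw [← Real.cosh_arcosh hx, Chebyshev.T_real_cosh, Int.cast_natCast]
  have hnonneg : 0 ≤ n * Real.arcosh x := mul_nonneg n.cast_nonneg (Real.arcosh_nonneg hx)
  calc Real.cosh (n * Real.arcosh x) ≤ Real.exp (n * Real.arcosh x) := by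
        rw [← Real.cosh_add_sinh]
        linarith [Real.sinh_nonneg_iff.2 hnonneg]
    _ ≤ Real.exp (n * s) := by gcongr

lemma eval_le_mul_exp_of_abs_le {A : ℝ[X]} {n : ℕ} (hA : A.degree ≤ n) {M : ℝ}
    (hM : ∀ x ∈ Set.Icc (-1 : ℝ) 1, |A.eval x| ≤ M) {x s : ℝ} (hs : 0 ≤ s) (hx : 1 ≤ x)
    (hxs : x ≤ 1 + s ^ 2 / 2) : A.eval x ≤ M * Real.exp (n * s) := by
  have hstrict : ∀ M' > M, A.eval x ≤ M' * Real.exp (n * s) := fun M' hMM' => by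
    have hM' : 0 < M' := (abs_nonneg _).trans_lt ((hM 0 (by simp)).trans_lt hMM')
    have hextremal := Chebyshev.eval_iterate_derivative_le_of_forall_abs_le_one (n := n)
      (P := C M'⁻¹ * A) (k := 0) hx ((degree_C_mul (inv_ne_zero hM'.ne')).trans_le hA)
      fun y hy => by
        rw [eval_mul, eval_C, abs_mul, abs_of_pos (inv_pos.2 hM'), inv_mul_le_one₀ hM']
        exact (hM y hy).trans hMM'.le
    simp only [Function.iterate_zero, id, eval_mul, eval_C] at hextremal
    rw [inv_mul_le_iff₀ hM'] at hextremal
    exact hextremal.trans (mul_le_mul_of_nonneg_left (eval_chebyshev_T_le_exp hs hx hxs n) hM'.le)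
  rw [← div_le_iff₀ (Real.exp_pos _)]
  exact le_of_forall_gt_imp_ge_of_dense fun M' h => (div_le_iff₀ (Real.exp_pos _)).2 (hstrict M' h)

lemma eval_one_le_of_monotoneOn {A : ℝ[X]} {n : ℕ} (hA : A.natDegree ≤ n)
    (hmono : MonotoneOn A.eval (Set.Icc (-1) 1)) (hA0 : A.eval (-1) = 0) {c s : ℝ} (hc : 0 < c)
    (hc1 : c ≤ 1) (hs : 0 ≤ s) (hcs : 2 / c - 1 ≤ 1 + s ^ 2 / 2) :
    A.eval 1 ≤ A.eval (2 * c - 1) * Real.exp (n * s) := by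
  have hlin : (C c * (X + 1) - 1 : ℝ[X]).natDegree ≤ 1 := by compute_degree
  have heval : ∀ x, (A.comp (C c * (X + 1) - 1)).eval x = A.eval (c * (x + 1) - 1) := fun x => by
    simp [eval_comp]
  have hdeg : (A.comp (C c * (X + 1) - 1)).degree ≤ n :=
    degree_le_of_natDegree_le (natDegree_comp_le.trans
      ((Nat.mul_le_mul_left _ hlin).trans (by rwa [mul_one])))
  have hbound : ∀ x ∈ Set.Icc (-1 : ℝ) 1,
      |(A.comp (C c * (X + 1) - 1)).eval x| ≤ A.eval (2 * c - 1) := fun x hx => by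
    have hmem : c * (x + 1) - 1 ∈ Set.Icc (-1 : ℝ) 1 := ⟨by nlinarith [hx.1], by nlinarith [hx.2]⟩
    have hnonneg : 0 ≤ A.eval (c * (x + 1) - 1) := hA0 ▸ hmono (by simp) hmem hmem.1
    rw [heval, abs_of_nonneg hnonneg]
    exact hmono hmem ⟨by linarith, by linarith⟩ (by nlinarith [hx.2])
  have hgrowth := eval_le_mul_exp_of_abs_le hdeg hbound hs
    (by rw [le_sub_iff_add_le, le_div_iff₀ hc]; linarith) hcs
  rwa [heval, sub_add_cancel, mul_div_cancel₀ _ hc.ne', show (2 : ℝ) - 1 = 1 by norm_num]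
    at hgrowth

/-! ### A Remez type inequality on the circle -/

lemma norm_sq_eval_circlePoint (P : ℂ[X]) (θ : ℝ) :
    ‖P.eval (circlePoint θ)‖ ^ 2 = ∑ i ∈ Finset.range (P.natDegree + 1),
      ∑ j ∈ Finset.range (P.natDegree + 1),
        (P.coeff i * (starRingEnd ℂ) (P.coeff j) * circlePoint ((i - j) * θ)).re := by
  have hcomplex : (Complex.normSq (P.eval (circlePoint θ)) : ℂ) =
      ∑ i ∈ Finset.range (P.natDegree + 1), ∑ j ∈ Finset.range (P.natDegree + 1),
        P.coeff i * (starRingEnd ℂ) (P.coeff j) * circlePoint ((i - j) * θ) := by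
    rw [← Complex.mul_conj, eval_eq_sum_range, map_sum, Finset.sum_mul_sum]
    refine Finset.sum_congr rfl fun i _ => Finset.sum_congr rfl fun j _ => ?_
    rw [map_mul, circlePoint_pow, circlePoint_pow, ← circlePoint_neg, mul_mul_mul_comm,
      ← circlePoint_add, sub_mul, ← sub_eq_add_neg]
  rw [← Complex.normSq_eq_norm_sq, ← Complex.ofReal_re (Complex.normSq _), hcomplex,
    Complex.re_sum]
  simp_rw [Complex.re_sum]

lemma exists_symmSq_eq_eval_cos (P : ℂ[X]) : ∃ R : ℝ[X], R.natDegree ≤ P.natDegree ∧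
    ∀ θ, symmSq P θ = R.eval (Real.cos (2 * Real.pi * θ)) := by
  refine ⟨∑ i ∈ Finset.range (P.natDegree + 1), ∑ j ∈ Finset.range (P.natDegree + 1),
    C (2 * (P.coeff i * (starRingEnd ℂ) (P.coeff j)).re) *
      Chebyshev.T ℝ ((i : ℤ) - (j : ℤ)), ?_, fun θ => ?_⟩
  · refine natDegree_sum_le_of_forall_le _ _ fun i hi => natDegree_sum_le_of_forall_le _ _
      fun j hj => (natDegree_C_mul_le _ _).trans ?_
    rw [Chebyshev.natDegree_T]
    simp only [Finset.mem_range] at hi hj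
    omega
  · rw [symmSq, norm_sq_eval_circlePoint, norm_sq_eval_circlePoint, ← Finset.sum_add_distrib,
      eval_finsetSum]
    refine Finset.sum_congr rfl fun i _ => ?_
    rw [← Finset.sum_add_distrib, eval_finsetSum]
    refine Finset.sum_congr rfl fun j _ => ?_
    have hcos : Real.cos (((i - j : ℤ) : ℝ) * (2 * Real.pi * θ)) =
        (circlePoint ((i - j) * θ)).re := by
      rw [circlePoint_re]
      push_cast
      ring_nf
    rw [eval_mul, eval_C, Chebyshev.T_real_cos, hcos, mul_neg, circlePoint_neg]
    simp only [Complex.mul_re, Complex.conj_re, Complex.conj_im]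
    ring

lemma exists_derivative_eq {K : Type*} [Field K] [CharZero K] (R : K[X]) (x₀ : K) :
    ∃ A : K[X], derivative A = R ∧ A.natDegree ≤ R.natDegree + 1 ∧ A.eval x₀ = 0 := by
  set B : K[X] := ∑ i ∈ Finset.range (R.natDegree + 1), C (R.coeff i / (i + 1)) * X ^ (i + 1)
  have hB : derivative B = R := by
    conv_rhs => rw [R.as_sum_range_C_mul_X_pow]
    simp only [B, derivative_sum, derivative_C_mul_X_pow]
    refine Finset.sum_congr rfl fun i _ => ?_
    rw [Nat.add_sub_cancel, Nat.cast_succ, div_mul_cancel₀ _ (Nat.cast_add_one_ne_zero i)]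
  refine ⟨B - C (B.eval x₀), by simp [hB], ?_, by simp⟩
  rw [natDegree_sub_C]
  refine natDegree_sum_le_of_forall_le _ _ fun i hi => (natDegree_C_mul_X_pow_le _ _).trans ?_
  simp only [Finset.mem_range] at hi
  omega

lemma exists_primitive_symmSq (P : ℂ[X]) : ∃ A : ℝ[X], A.natDegree ≤ P.natDegree + 1 ∧
    MonotoneOn A.eval (Set.Icc (-1) 1) ∧ A.eval (-1) = 0 ∧ ∀ a b,
      ∫ θ in a..b, symmSq P θ * (2 * Real.pi * Real.sin (2 * Real.pi * θ)) =
        A.eval (Real.cos (2 * Real.pi * a)) - A.eval (Real.cos (2 * Real.pi * b)) := by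
  obtain ⟨R, hRdeg, hR⟩ := exists_symmSq_eq_eval_cos P
  obtain ⟨A, hA, hAdeg, hA0⟩ := exists_derivative_eq R (-1)
  have hRnonneg : ∀ x ∈ Set.Icc (-1 : ℝ) 1, 0 ≤ R.eval x := fun x hx => by
    have hx' := hR (Real.arccos x / (2 * Real.pi))
    rw [mul_div_cancel₀ _ Real.two_pi_pos.ne', Real.cos_arccos hx.1 hx.2] at hx'
    exact hx' ▸ symmSq_nonneg _ _
  refine ⟨A, by omega, ?_, hA0, fun a b => ?_⟩
  · refine monotoneOn_of_deriv_nonneg (convex_Icc _ _) A.continuous.continuousOn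
      A.differentiable.differentiableOn fun x hx => ?_
    rw [A.deriv, hA]
    exact hRnonneg x (interior_subset hx)
  · have hderiv : ∀ θ, HasDerivAt (fun θ => -A.eval (Real.cos (2 * Real.pi * θ)))
        (symmSq P θ * (2 * Real.pi * Real.sin (2 * Real.pi * θ))) θ := fun θ => by
      have hlin : HasDerivAt (fun θ : ℝ => 2 * Real.pi * θ) (2 * Real.pi) θ := by
        simpa using (hasDerivAt_id θ).const_mul (2 * Real.pi)
      refine ((A.hasDerivAt (Real.cos (2 * Real.pi * θ))).comp θ hlin.cos).neg.congr_deriv ?_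
      rw [hR, hA]
      ring
    rw [intervalIntegral.integral_eq_sub_of_hasDerivAt (fun θ _ => hderiv θ)
      (Continuous.intervalIntegrable (by fun_prop) _ _)]
    ring

lemma cos_two_pi_mul (θ : ℝ) :
    Real.cos (2 * Real.pi * θ) = 2 * Real.cos (Real.pi * θ) ^ 2 - 1 := by
  rw [mul_assoc, Real.cos_two_mul]

lemma cos_sq_pi_mul_le {θ : ℝ} (hθ : 0 ≤ θ) (hθ' : θ ≤ 1 / 2) :
    Real.cos (Real.pi * θ) ^ 2 ≤ 1 - 4 * θ ^ 2 := by
  have hsin := Real.mul_le_sin (x := Real.pi * θ) (by positivity) (by nlinarith [Real.pi_pos])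
  rw [← mul_assoc, div_mul_cancel₀ _ Real.pi_ne_zero] at hsin
  have := pow_le_pow_left₀ (by positivity) hsin 2
  linarith [Real.sin_sq_add_cos_sq (Real.pi * θ)]

lemma half_le_cos_sq_pi_mul {θ : ℝ} (hθ : 0 ≤ θ) (hθ' : θ ≤ 1 / 4) :
    1 / 2 ≤ Real.cos (Real.pi * θ) ^ 2 := by
  have hpi := Real.pi_pos
  have h0 : 0 ≤ Real.cos (2 * Real.pi * θ) :=
    Real.cos_nonneg_of_neg_pi_div_two_le_of_le (by nlinarith) (by nlinarith)
  linarith [cos_two_pi_mul θ]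

lemma two_div_cos_sq_pi_mul_sub_one_le {θ : ℝ} (hθ : 0 ≤ θ) (hθ' : θ ≤ 1 / 4) :
    2 / Real.cos (Real.pi * θ) ^ 2 - 1 ≤ 1 + (9 * θ) ^ 2 / 2 := by
  have hhalf := half_le_cos_sq_pi_mul hθ hθ'
  have hsin : Real.sin (Real.pi * θ) ^ 2 ≤ (Real.pi * θ) ^ 2 := sq_le_sq₀
    (Real.sin_nonneg_of_nonneg_of_le_pi (by positivity) (by nlinarith [Real.pi_pos]))
    (by positivity) |>.2 (Real.sin_le (by positivity))
  have hpi : Real.pi ^ 2 ≤ 10 := by nlinarith [Real.pi_lt_d2, Real.pi_pos]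
  have hpi' : (Real.pi * θ) ^ 2 ≤ 10 * θ ^ 2 := by
    rw [mul_pow]; exact mul_le_mul_of_nonneg_right hpi (sq_nonneg θ)
  rw [tsub_le_iff_right, div_le_iff₀ (by linarith)]
  nlinarith [Real.sin_sq_add_cos_sq (Real.pi * θ), sq_nonneg θ]

lemma self_le_sin_two_pi_mul {θ : ℝ} (hθ : 0 ≤ θ) (hθ' : θ ≤ 1 / 4) :
    θ ≤ Real.sin (2 * Real.pi * θ) := by
  have hsin := Real.mul_le_sin (x := 2 * Real.pi * θ) (by positivity)
    (by nlinarith [Real.pi_pos])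
  have hcancel : 2 / Real.pi * (2 * Real.pi * θ) = 4 * θ := by field_simp; ring
  linarith

lemma exists_polynomial_integral_symmSq_bounds (P : ℂ[X]) {δ : ℝ} (hδ : 0 ≤ δ)
    (hδ' : δ ≤ 1 / 4) : ∃ A : ℝ[X], A.natDegree ≤ P.natDegree + 1 ∧
      MonotoneOn A.eval (Set.Icc (-1) 1) ∧ A.eval (-1) = 0 ∧
      2 * Real.pi * (∫ θ in 0..δ, symmSq P θ * θ) ≤
        A.eval 1 - A.eval (Real.cos (2 * Real.pi * δ)) ∧
      A.eval (Real.cos (2 * Real.pi * δ)) ≤ 2 * Real.pi * ∫ θ in δ..(1 / 2), symmSq P θ := by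
  obtain ⟨A, hAdeg, hmono, hA0, hprim⟩ := exists_primitive_symmSq P
  refine ⟨A, hAdeg, hmono, hA0, ?_, ?_⟩
  · have hnear := hprim 0 δ
    rw [mul_zero, Real.cos_zero] at hnear
    rw [← hnear, ← intervalIntegral.integral_const_mul]
    refine intervalIntegral.integral_mono_on hδ
      (Continuous.intervalIntegrable (by fun_prop) _ _)
      (Continuous.intervalIntegrable (by fun_prop) _ _) fun θ hθ => ?_
    linarith [mul_le_mul_of_nonneg_left (self_le_sin_two_pi_mul hθ.1 (hθ.2.trans hδ'))
      (mul_nonneg (symmSq_nonneg P θ) Real.two_pi_pos.le)]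
  · have hfar := hprim δ (1 / 2)
    rw [show 2 * Real.pi * (1 / 2) = Real.pi by ring, Real.cos_pi, hA0, sub_zero] at hfar
    rw [← hfar, ← intervalIntegral.integral_const_mul]
    refine intervalIntegral.integral_mono_on (by linarith)
      (Continuous.intervalIntegrable (by fun_prop) _ _)
      (Continuous.intervalIntegrable (by fun_prop) _ _) fun θ _ => ?_
    linarith [mul_le_mul_of_nonneg_left (Real.sin_le_one (2 * Real.pi * θ))
      (mul_nonneg (symmSq_nonneg P θ) Real.two_pi_pos.le)]

lemma integral_symmSq_mul_self_le (P : ℂ[X]) {δ : ℝ} (hδ : 0 ≤ δ) (hδ' : δ ≤ 1 / 4) :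
    ∫ θ in 0..δ, symmSq P θ * θ ≤
      Real.exp ((P.natDegree + 1) * (9 * δ)) * ∫ θ in δ..(1 / 2), symmSq P θ := by
  obtain ⟨A, hAdeg, hmono, hA0, hnear, hfar⟩ := exists_polynomial_integral_symmSq_bounds P hδ hδ'
  rw [cos_two_pi_mul] at hnear hfar
  set c := Real.cos (Real.pi * δ) ^ 2
  have hc0 : 1 / 2 ≤ c := half_le_cos_sq_pi_mul hδ hδ'
  have hc1 : c ≤ 1 := Real.cos_sq_le_one _
  have hgrowth := eval_one_le_of_monotoneOn hAdeg hmono hA0 (by linarith) hc1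
    (by positivity) (two_div_cos_sq_pi_mul_sub_one_le hδ hδ')
  have hnonneg : 0 ≤ A.eval (2 * c - 1) :=
    hA0 ▸ hmono (by simp) ⟨by linarith, by linarith⟩ (by linarith)
  push_cast at hgrowth
  refine le_of_mul_le_mul_left ?_ Real.two_pi_pos
  calc 2 * Real.pi * ∫ θ in 0..δ, symmSq P θ * θ
      ≤ A.eval (2 * c - 1) * Real.exp ((P.natDegree + 1) * (9 * δ)) := by linarith
    _ ≤ (2 * Real.pi * ∫ θ in δ..(1 / 2), symmSq P θ) *
        Real.exp ((P.natDegree + 1) * (9 * δ)) := by gcongr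
    _ = _ := by ring

/-! ### The upper bound for `|log e_n|` -/

section PiecewiseIntegrals

variable {f g : ℝ → ℝ} {a d b : ℝ}

lemma intervalIntegrable_ite_lt (had : a ≤ d) (hdb : d ≤ b)
    (hf : IntervalIntegrable f volume a d) (hg : IntervalIntegrable g volume d b) :
    IntervalIntegrable (fun θ => if θ < d then f θ else g θ) volume a b := by
  refine IntervalIntegrable.trans (b := d) (hf.congr_uIoo fun θ hθ => ?_)
    (hg.congr_uIoo fun θ hθ => ?_)
  · rw [Set.uIoo_of_le had] at hθ
    exact (if_pos hθ.2).symm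
  · rw [Set.uIoo_of_le hdb] at hθ
    exact (if_neg hθ.1.not_gt).symm

lemma integral_ite_lt (had : a ≤ d) (hdb : d ≤ b)
    (hf : IntervalIntegrable f volume a d) (hg : IntervalIntegrable g volume d b) :
    ∫ θ in a..b, (if θ < d then f θ else g θ) = (∫ θ in a..d, f θ) + ∫ θ in d..b, g θ := by
  have hfd : Set.EqOn f (fun θ => if θ < d then f θ else g θ) (Set.uIoo a d) := fun θ hθ => by
    rw [Set.uIoo_of_le had] at hθ
    exact (if_pos hθ.2).symm
  have hgd : Set.EqOn g (fun θ => if θ < d then f θ else g θ) (Set.uIoo d b) := fun θ hθ => by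
    rw [Set.uIoo_of_le hdb] at hθ
    exact (if_neg hθ.1.not_gt).symm
  rw [← intervalIntegral.integral_add_adjacent_intervals (hf.congr_uIoo hfd) (hg.congr_uIoo hgd),
    intervalIntegral.integral_congr_uIoo hfd, intervalIntegral.integral_congr_uIoo hgd]

end PiecewiseIntegrals

/-- The logarithm of the weight to which Jensen's inequality is applied: `e^{-h}` away from `0`,
and `θ e^{-B}` on `(0, δ)`. The factor `θ` makes the Remez inequality applicable there and costs
only `δ log δ - δ` in the integral of the logarithm. -/
noncomputable def logWeight (h : ℝ → ℝ) (δ B θ : ℝ) : ℝ :=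
  if θ < δ then Real.log θ - B else -h θ

lemma exp_logWeight (h : ℝ → ℝ) (δ B : ℝ) {θ : ℝ} (hθ : 0 < θ) :
    Real.exp (logWeight h δ B θ) = if θ < δ then θ * Real.exp (-B) else Real.exp (-h θ) := by
  rw [logWeight, apply_ite Real.exp, sub_eq_add_neg, Real.exp_add, Real.exp_log hθ]

namespace IsDeepProfile

variable {h : ℝ → ℝ} {δ : ℝ}

lemma intervalIntegrable (hh : IsDeepProfile h) (hδ : 0 < δ) (hδ' : δ ≤ 1 / 2) :
    IntervalIntegrable h volume δ (1 / 2) :=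
  AntitoneOn.intervalIntegrable (hh.anti.mono fun θ hθ => by
    rw [Set.uIcc_of_le hδ'] at hθ
    exact ⟨hδ.trans_le hθ.1, hθ.2⟩)

lemma intervalIntegrable_logWeight (hh : IsDeepProfile h) (B : ℝ) (hδ : 0 < δ) (hδ' : δ ≤ 1 / 2) :
    IntervalIntegrable (logWeight h δ B) volume 0 (1 / 2) :=
  intervalIntegrable_ite_lt hδ.le hδ'
    (intervalIntegral.intervalIntegrable_log'.sub intervalIntegrable_const)
    (hh.intervalIntegrable hδ hδ').neg

lemma integral_logWeight (hh : IsDeepProfile h) (B : ℝ) (hδ : 0 < δ) (hδ' : δ ≤ 1 / 2) :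
    ∫ θ in 0..(1 / 2), logWeight h δ B θ =
      δ * Real.log δ - δ - δ * B - ∫ θ in δ..(1 / 2), h θ := by
  simp only [logWeight]
  rw [integral_ite_lt hδ.le hδ'
      (intervalIntegral.intervalIntegrable_log'.sub intervalIntegrable_const)
      (g := fun θ => -h θ) (hh.intervalIntegrable hδ hδ').neg,
    intervalIntegral.integral_sub intervalIntegral.intervalIntegrable_log'
      intervalIntegrable_const, intervalIntegral.integral_neg, integral_log]
  simp only [intervalIntegral.integral_const, smul_eq_mul, sub_zero, zero_mul, add_zero]
  ring

lemma intervalIntegrable_mul_exp_neg_right (hh : IsDeepProfile h) (hδ : 0 ≤ δ) (hδ' : δ ≤ 1 / 2)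
    {f : ℝ → ℝ} (hf : Continuous f) :
    IntervalIntegrable (fun θ => f θ * Real.exp (-h θ)) volume δ (1 / 2) :=
  (hh.intervalIntegrable_mul_exp_neg hf).mono_set <| Set.uIcc_subset_uIcc
    (by rw [Set.uIcc_of_le (by norm_num)]; exact ⟨hδ, hδ'⟩) Set.right_mem_uIcc

section ExpLogWeight

variable {f : ℝ → ℝ}

lemma eqOn_mul_exp_logWeight (h : ℝ → ℝ) (δ B : ℝ) (f : ℝ → ℝ) :
    Set.EqOn (fun θ => if θ < δ then Real.exp (-B) * (f θ * θ) else f θ * Real.exp (-h θ))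
      (fun θ => f θ * Real.exp (logWeight h δ B θ)) (Set.uIoo 0 (1 / 2)) := fun θ hθ => by
  rw [Set.uIoo_of_le (by norm_num)] at hθ
  simp only [exp_logWeight h δ B hθ.1, mul_ite]
  congr 1
  ring

lemma intervalIntegrable_mul_exp_logWeight (hh : IsDeepProfile h) (B : ℝ) (hδ : 0 ≤ δ)
    (hδ' : δ ≤ 1 / 2) (hf : Continuous f) :
    IntervalIntegrable (fun θ => f θ * Real.exp (logWeight h δ B θ)) volume 0 (1 / 2) :=
  (intervalIntegrable_ite_lt hδ hδ' (Continuous.intervalIntegrable (by fun_prop) _ _)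
    (hh.intervalIntegrable_mul_exp_neg_right hδ hδ' hf)).congr_uIoo
      (eqOn_mul_exp_logWeight h δ B f)

lemma integral_mul_exp_logWeight (hh : IsDeepProfile h) (B : ℝ) (hδ : 0 ≤ δ)
    (hδ' : δ ≤ 1 / 2) (hf : Continuous f) :
    ∫ θ in 0..(1 / 2), f θ * Real.exp (logWeight h δ B θ) =
      Real.exp (-B) * (∫ θ in 0..δ, f θ * θ) + ∫ θ in δ..(1 / 2), f θ * Real.exp (-h θ) := by
  rw [← intervalIntegral.integral_congr_uIoo (eqOn_mul_exp_logWeight h δ B f),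
    integral_ite_lt hδ hδ' (Continuous.intervalIntegrable (by fun_prop) _ _)
      (hh.intervalIntegrable_mul_exp_neg_right hδ hδ' hf), intervalIntegral.integral_const_mul]

end ExpLogWeight

lemma exp_neg_mul_integral_symmSq_le (hh : IsDeepProfile h) (P : ℂ[X]) (hδ : 0 < δ)
    (hδ' : δ ≤ 1 / 2) : Real.exp (-h δ) * ∫ θ in δ..(1 / 2), symmSq P θ ≤
      ∫ θ in δ..(1 / 2), symmSq P θ * Real.exp (-h θ) := by
  rw [← intervalIntegral.integral_const_mul]
  refine intervalIntegral.integral_mono_on hδ' (Continuous.intervalIntegrable (by fun_prop) _ _)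
    (hh.intervalIntegrable_mul_exp_neg_right hδ.le hδ' (continuous_symmSq P)) fun θ hθ => ?_
  rw [mul_comm]
  exact mul_le_mul_of_nonneg_left (Real.exp_le_exp.2 (neg_le_neg
    (hh.anti ⟨hδ, hδ'⟩ ⟨hδ.trans_le hθ.1, hθ.2⟩ hθ.1))) (symmSq_nonneg _ _)

lemma integral_symmSq_mul_exp_neg_le_energy (hh : IsDeepProfile h) (P : ℂ[X]) (hδ : 0 ≤ δ)
    (hδ' : δ ≤ 1 / 2) : ∫ θ in δ..(1 / 2), symmSq P θ * Real.exp (-h θ) ≤ energy h P :=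
  intervalIntegral.integral_mono_interval hδ hδ' le_rfl
    (ae_of_all _ fun θ => mul_nonneg (symmSq_nonneg P θ) (Real.exp_pos _).le)
    (hh.intervalIntegrable_mul_exp_neg (continuous_symmSq P))

lemma integral_symmSq_mul_exp_logWeight_le (hh : IsDeepProfile h) (P : ℂ[X]) (hδ : 0 < δ)
    (hδ' : δ ≤ 1 / 4) :
    ∫ θ in 0..(1 / 2),
        symmSq P θ * Real.exp (logWeight h δ (h δ + (P.natDegree + 1) * (9 * δ)) θ) ≤
      2 * energy h P := by
  have hδ2 : δ ≤ 1 / 2 := by linarith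
  have henergy := hh.integral_symmSq_mul_exp_neg_le_energy P hδ.le hδ2
  rw [hh.integral_mul_exp_logWeight _ hδ.le hδ2 (continuous_symmSq P)]
  have hnear : Real.exp (-(h δ + (P.natDegree + 1) * (9 * δ))) * (∫ θ in 0..δ, symmSq P θ * θ) ≤
      Real.exp (-h δ) * ∫ θ in δ..(1 / 2), symmSq P θ := by
    refine (mul_le_mul_of_nonneg_left (integral_symmSq_mul_self_le P hδ.le hδ')
      (Real.exp_pos _).le).trans_eq ?_
    rw [← mul_assoc, ← Real.exp_add, neg_add, neg_add_cancel_right]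
  linarith [hh.exp_neg_mul_integral_symmSq_le P hδ hδ2]

lemma le_energy_of_monic (hh : IsDeepProfile h) {P : ℂ[X]} (hP : P.Monic) (hδ : 0 < δ)
    (hδ' : δ ≤ 1 / 4) :
    Real.exp (2 * (δ * Real.log δ - δ - δ * (h δ + (P.natDegree + 1) * (9 * δ)) -
      ∫ θ in δ..(1 / 2), h θ)) ≤ 2 * energy h P := by
  have hδ2 : δ ≤ 1 / 2 := by linarith
  rw [← hh.integral_logWeight _ hδ hδ2]
  refine (exp_integral_le_integral_symmSq_mul_exp hP (hh.intervalIntegrable_logWeight _ hδ hδ2)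
    ?_).trans (hh.integral_symmSq_mul_exp_logWeight_le P hδ hδ')
  simpa only [one_mul] using
    hh.intervalIntegrable_mul_exp_logWeight _ hδ.le hδ2 (continuous_const (y := (1 : ℝ)))

lemma exp_neg_le_szegoError (hh : IsDeepProfile h) (n : ℕ) (hδ : 0 < δ) (hδ' : δ ≤ 1 / 4) :
    Real.exp (-(3 + δ * h δ + 9 * (n * δ ^ 2) + ∫ θ in δ..(1 / 2), h θ)) ≤
      szegoError (deepZeroMeasure h) n := by
  set V := 3 + δ * h δ + 9 * (n * δ ^ 2) + ∫ θ in δ..(1 / 2), h θ with hV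
  refine hh.le_szegoError fun P hP hn => Real.le_sqrt_of_sq_le ?_
  have henergy := hh.le_energy_of_monic hP hδ hδ'
  rw [hn] at henergy
  have hlog : -1 ≤ δ * Real.log δ := by
    have := mul_le_mul_of_nonneg_left (Real.one_sub_inv_le_log_of_pos hδ) hδ.le
    rw [mul_sub, mul_inv_cancel₀ hδ.ne'] at this
    linarith
  have hexp : 2 * Real.exp (-V) ^ 2 ≤ Real.exp (1 + 2 * -V) := by
    rw [Real.exp_add, two_mul (-V), Real.exp_add, ← sq]
    exact mul_le_mul_of_nonneg_right (by linarith [Real.add_one_le_exp 1]) (sq_nonneg _)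
  have hle : Real.exp (1 + 2 * -V) ≤ Real.exp (2 * (δ * Real.log δ - δ -
      δ * (h δ + (n + 1) * (9 * δ)) - ∫ θ in δ..(1 / 2), h θ)) := by
    refine Real.exp_le_exp.2 ?_
    rw [hV]
    nlinarith
  linarith

lemma szegoError_pos (hh : IsDeepProfile h) (n : ℕ) : 0 < szegoError (deepZeroMeasure h) n :=
  (Real.exp_pos _).trans_le (hh.exp_neg_le_szegoError n (δ := 1 / 4) (by norm_num) le_rfl)

lemma neg_log_szegoError_le (hh : IsDeepProfile h) (n : ℕ) (hδ : 0 < δ) (hδ' : δ ≤ 1 / 4) :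
    -Real.log (szegoError (deepZeroMeasure h) n) ≤
      3 + δ * h δ + 9 * (n * δ ^ 2) + ∫ θ in δ..(1 / 2), h θ := by
  rw [neg_le, Real.le_log_iff_exp_le (hh.szegoError_pos n)]
  exact hh.exp_neg_le_szegoError n hδ hδ'

end IsDeepProfile

/-! ### Test polynomials and lower bounds for `|log e_n|` -/

namespace IsDeepProfile

variable {h : ℝ → ℝ}

lemma energy_le (hh : IsDeepProfile h) {P : ℂ[X]} {M : ℝ}
    (H : ∀ θ : ℝ, |θ| ∈ Set.Ioc (0 : ℝ) (1 / 2) →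
      ‖P.eval (circlePoint θ)‖ ^ 2 * Real.exp (-h |θ|) ≤ M) : energy h P ≤ M := by
  have hbound : ∀ θ ∈ Set.Ioo (0 : ℝ) (1 / 2), symmSq P θ * Real.exp (-h θ) ≤ 2 * M :=
    fun θ hθ => by
      have hpos := H θ (by rw [abs_of_pos hθ.1]; exact ⟨hθ.1, hθ.2.le⟩)
      have hneg := H (-θ) (by rw [abs_neg, abs_of_pos hθ.1]; exact ⟨hθ.1, hθ.2.le⟩)
      rw [abs_neg, abs_of_pos hθ.1] at hneg
      rw [abs_of_pos hθ.1] at hpos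
      rw [symmSq, add_mul]
      linarith
  calc energy h P ≤ ∫ _ in (0 : ℝ)..(1 / 2), 2 * M :=
        intervalIntegral.integral_mono_on_of_le_Ioo (by norm_num)
          (hh.intervalIntegrable_mul_exp_neg (continuous_symmSq P)) intervalIntegrable_const hbound
    _ = M := by rw [intervalIntegral.integral_const, smul_eq_mul]; ring

lemma le_neg_log_szegoError (hh : IsDeepProfile h) {P : ℂ[X]} (hP : P.Monic) {n : ℕ}
    (hn : P.natDegree ≤ n) {x : ℝ}
    (H : ∀ θ : ℝ, |θ| ∈ Set.Ioc (0 : ℝ) (1 / 2) →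
      ‖P.eval (circlePoint θ)‖ ^ 2 * Real.exp (-h |θ|) ≤ Real.exp (-(2 * x))) :
    x ≤ -Real.log (szegoError (deepZeroMeasure h) n) := by
  rw [le_neg, Real.log_le_iff_le_exp (hh.szegoError_pos n)]
  calc szegoError (deepZeroMeasure h) n ≤ Real.sqrt (energy h P) :=
        hh.szegoError_le_of_natDegree_le hP hn
    _ ≤ Real.sqrt (Real.exp (-(2 * x))) := Real.sqrt_le_sqrt (hh.energy_le H)
    _ = Real.exp (-x) := by
        rw [show -(2 * x) = -x + -x by ring, Real.exp_add, Real.sqrt_mul_self (Real.exp_pos _).le]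

end IsDeepProfile

/-! ### Chebyshev polynomials of an arc -/

/-- The monic lift of `A` to a self-reciprocal polynomial of twice the degree: in terms of the
roots, `2 (cos 2πθ - r)` becomes `t ^ 2 - 2 r t + 1`, which is `2 (cos 2πθ - r) t` at
`t = e^{2πiθ}`. -/
noncomputable def cosineLift (A : ℂ[X]) : ℂ[X] :=
  (A.roots.map fun r => X ^ 2 - C (2 * r) * X + 1).prod

lemma monic_X_sq_sub_add_one (a : ℂ) : (X ^ 2 - C a * X + 1 : ℂ[X]).Monic := by monicity!

lemma monic_cosineLift (A : ℂ[X]) : (cosineLift A).Monic :=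
  monic_multiset_prod_of_monic _ _ fun _ _ => monic_X_sq_sub_add_one _

lemma natDegree_cosineLift (A : ℂ[X]) : (cosineLift A).natDegree = 2 * A.natDegree := by
  have hdeg : ∀ a : ℂ, (X ^ 2 - C a * X + 1 : ℂ[X]).natDegree = 2 := fun a => by compute_degree!
  rw [cosineLift, natDegree_multiset_prod_of_monic _ (by
    simp only [Multiset.mem_map, forall_exists_index, and_imp, forall_apply_eq_imp_iff₂]
    exact fun r _ => monic_X_sq_sub_add_one _), Multiset.map_map]
  simp only [Function.comp_def, hdeg, Multiset.map_const', Multiset.sum_replicate,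
    smul_eq_mul, (IsAlgClosed.splits A).natDegree_eq_card_roots]
  exact mul_comm _ _

lemma norm_eval_circlePoint_X_sq_sub_add_one (r : ℂ) (θ : ℝ) :
    ‖(X ^ 2 - C (2 * r) * X + 1 : ℂ[X]).eval (circlePoint θ)‖ =
      2 * ‖(Real.cos (2 * Real.pi * θ) : ℂ) - r‖ := by
  have hconj : (1 : ℂ) = circlePoint θ * (starRingEnd ℂ) (circlePoint θ) := by
    rw [Complex.mul_conj, Complex.normSq_eq_norm_sq, norm_circlePoint]; simp
  have hcos : (2 * Real.cos (2 * Real.pi * θ) : ℂ) =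
      circlePoint θ + (starRingEnd ℂ) (circlePoint θ) := by
    rw [← circlePoint_re, Complex.add_conj]; push_cast; ring
  have hfactor : (X ^ 2 - C (2 * r) * X + 1 : ℂ[X]).eval (circlePoint θ) =
      circlePoint θ * (2 * ((Real.cos (2 * Real.pi * θ) : ℂ) - r)) := by
    simp only [eval_add, eval_sub, eval_mul, eval_pow, eval_X, eval_C, eval_one]
    rw [mul_sub, hcos]
    linear_combination hconj
  rw [hfactor, norm_mul, norm_mul, norm_circlePoint, one_mul, Complex.norm_two]

lemma norm_leadingCoeff_mul_norm_eval_cosineLift (A : ℂ[X]) (θ : ℝ) :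
    ‖A.leadingCoeff‖ * ‖(cosineLift A).eval (circlePoint θ)‖ =
      2 ^ A.natDegree * ‖A.eval (Real.cos (2 * Real.pi * θ) : ℂ)‖ := by
  have hsplits := IsAlgClosed.splits A
  rw [hsplits.eval_eq_prod_roots, cosineLift, eval_multiset_prod, norm_mul,
    hsplits.natDegree_eq_card_roots, mul_left_comm]
  congr 1
  have hnorm : ∀ s : Multiset ℂ, ‖s.prod‖ = (s.map norm).prod := map_multiset_prod normHom
  rw [hnorm, hnorm, Multiset.map_map, Multiset.map_map, Multiset.map_map]
  simp only [Function.comp_def, norm_eval_circlePoint_X_sq_sub_add_one, Multiset.prod_map_mul,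
    Multiset.map_const', Multiset.prod_replicate]

lemma exists_monic_norm_eval_le_chebyshev (m : ℕ) {c : ℝ} (hc : 0 < c) :
    ∃ Q : ℂ[X], Q.Monic ∧ Q.natDegree = 2 * m ∧ ∀ θ, ‖Q.eval (circlePoint θ)‖ ≤
      2 * c ^ m * |(Chebyshev.T ℝ m).eval ((Real.cos (2 * Real.pi * θ) + 1) / c - 1)| := by
  set L : ℝ[X] := C c⁻¹ * X + C (c⁻¹ - 1)
  have hL : L.natDegree = 1 := natDegree_linear (inv_ne_zero hc.ne')
  have hT : (Chebyshev.T ℝ m).natDegree = m := by rw [Chebyshev.natDegree_T]; simp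
  set A : ℂ[X] := ((Chebyshev.T ℝ m).comp L).map (algebraMap ℝ ℂ) with hA
  have hAdeg : A.natDegree = m := by rw [hA, natDegree_map, natDegree_comp, hT, hL, mul_one]
  have hAlead : ‖A.leadingCoeff‖ = 2 ^ (m - 1) * c⁻¹ ^ m := by
    rw [hA, leadingCoeff_map, leadingCoeff_comp (by simp [hL]), Chebyshev.leadingCoeff_T,
      leadingCoeff_linear (inv_ne_zero hc.ne'), hT, norm_algebraMap', Real.norm_of_nonneg]
    · simp
    · positivity
  have hAeval : ∀ x : ℝ, ‖A.eval (x : ℂ)‖ = |(Chebyshev.T ℝ m).eval ((x + 1) / c - 1)| := by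
    intro x
    rw [hA, ← Complex.coe_algebraMap, eval_map_apply, norm_algebraMap', Real.norm_eq_abs, eval_comp]
    congr 2
    simp only [L, eval_add, eval_mul, eval_C, eval_X]
    ring
  refine ⟨cosineLift A, monic_cosineLift A, by rw [natDegree_cosineLift, hAdeg], fun θ => ?_⟩
  have hlift := norm_leadingCoeff_mul_norm_eval_cosineLift A θ
  rw [hAlead, hAdeg, hAeval, inv_pow, ← div_eq_mul_inv, div_mul_eq_mul_div,
    div_eq_iff (by positivity)] at hlift
  have htwo : (2 : ℝ) ^ m ≤ 2 * 2 ^ (m - 1) := by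
    rw [← pow_succ']
    exact pow_le_pow_right₀ (by norm_num) (by omega)
  refine le_of_mul_le_mul_left ?_ (by positivity : (0 : ℝ) < 2 ^ (m - 1))
  rw [hlift]
  calc 2 ^ m * |(Chebyshev.T ℝ m).eval ((Real.cos (2 * Real.pi * θ) + 1) / c - 1)| * c ^ m
      ≤ 2 * 2 ^ (m - 1) *
          |(Chebyshev.T ℝ m).eval ((Real.cos (2 * Real.pi * θ) + 1) / c - 1)| * c ^ m := by gcongr
    _ = _ := by ring

lemma cos_two_pi_mul_le_iff {δ θ : ℝ} (hδ : 0 ≤ δ) (hδ' : δ ≤ 1 / 2) (hθ : |θ| ≤ 1 / 2) :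
    Real.cos (2 * Real.pi * θ) ≤ Real.cos (2 * Real.pi * δ) ↔ δ ≤ |θ| := by
  have hpi := Real.two_pi_pos
  rw [← Real.cos_abs (2 * Real.pi * θ), abs_mul, abs_of_pos hpi,
    Real.strictAntiOn_cos.le_iff_ge ⟨by positivity, by nlinarith⟩ ⟨by positivity, by nlinarith⟩]
  exact mul_le_mul_iff_right₀ hpi

lemma abs_eval_chebyshev_T_le_one_of_cos_le {c θ : ℝ} (hc : 0 < c)
    (hθ : Real.cos (2 * Real.pi * θ) ≤ 2 * c - 1) (m : ℕ) :
    |(Chebyshev.T ℝ m).eval ((Real.cos (2 * Real.pi * θ) + 1) / c - 1)| ≤ 1 := by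
  have hcos : 0 ≤ Real.cos (2 * Real.pi * θ) + 1 := by
    linarith [Real.neg_one_le_cos (2 * Real.pi * θ)]
  refine Chebyshev.abs_eval_T_real_le_one _ (abs_le.2 ⟨by linarith [div_nonneg hcos hc.le], ?_⟩)
  rw [sub_le_iff_le_add, div_le_iff₀ hc]
  linarith

lemma abs_eval_chebyshev_T_le_exp_of_le_cos {δ θ : ℝ} (hδ : 0 ≤ δ) (hδ' : δ ≤ 1 / 4)
    (hθ : 2 * Real.cos (Real.pi * δ) ^ 2 - 1 ≤ Real.cos (2 * Real.pi * θ)) (m : ℕ) :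
    |(Chebyshev.T ℝ m).eval ((Real.cos (2 * Real.pi * θ) + 1) / Real.cos (Real.pi * δ) ^ 2 - 1)| ≤
      Real.exp (m * (9 * δ)) := by
  have hc : 0 < Real.cos (Real.pi * δ) ^ 2 := by linarith [half_le_cos_sq_pi_mul hδ hδ']
  have hge : 1 ≤ (Real.cos (2 * Real.pi * θ) + 1) / Real.cos (Real.pi * δ) ^ 2 - 1 := by
    rw [le_sub_iff_add_le, le_div_iff₀ hc]
    linarith
  rw [abs_of_nonneg (zero_le_one.trans (Chebyshev.one_le_eval_T_real m hge))]
  refine eval_chebyshev_T_le_exp (by positivity) hge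
    (le_trans ?_ (two_div_cos_sq_pi_mul_sub_one_le hδ hδ')) m
  gcongr
  linarith [Real.cos_le_one (2 * Real.pi * θ)]

lemma exists_monic_small_off_arc (m : ℕ) {δ : ℝ} (hδ : 0 ≤ δ) (hδ' : δ ≤ 1 / 4) :
    ∃ Q : ℂ[X], Q.Monic ∧ Q.natDegree = 2 * m ∧
      (∀ θ, δ ≤ |θ| → |θ| ≤ 1 / 2 →
        ‖Q.eval (circlePoint θ)‖ ≤ 2 * Real.exp (-(4 * (m * δ ^ 2)))) ∧
      (∀ θ, |θ| ≤ δ → ‖Q.eval (circlePoint θ)‖ ≤ 2 * Real.exp (m * (9 * δ))) := by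
  have hδ2 : δ ≤ 1 / 2 := by linarith
  have hc0 : 0 < Real.cos (Real.pi * δ) ^ 2 := by linarith [half_le_cos_sq_pi_mul hδ hδ']
  have hcm : (Real.cos (Real.pi * δ) ^ 2) ^ m ≤ Real.exp (-(4 * (m * δ ^ 2))) := by
    rw [show -(4 * (m * δ ^ 2)) = m * -(4 * δ ^ 2) by ring, Real.exp_nat_mul]
    gcongr
    linarith [Real.add_one_le_exp (-(4 * δ ^ 2)), cos_sq_pi_mul_le hδ hδ2]
  obtain ⟨Q, hQ, hQdeg, hQle⟩ := exists_monic_norm_eval_le_chebyshev m hc0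
  refine ⟨Q, hQ, hQdeg, fun θ hθ hθ' => (hQle θ).trans ?_, fun θ hθ => (hQle θ).trans ?_⟩
  · have hcos := (cos_two_pi_mul_le_iff hδ hδ2 hθ').2 hθ
    rw [cos_two_pi_mul δ] at hcos
    calc 2 * (Real.cos (Real.pi * δ) ^ 2) ^ m * |_|
        ≤ 2 * Real.exp (-(4 * (m * δ ^ 2))) * 1 := by
          gcongr
          exact abs_eval_chebyshev_T_le_one_of_cos_le hc0 hcos m
      _ = _ := mul_one _
  · have hcos := (cos_two_pi_mul_le_iff (abs_nonneg θ) (by linarith)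
      (by linarith [abs_of_nonneg hδ] : |δ| ≤ 1 / 2)).2 (by rwa [abs_of_nonneg hδ])
    rw [cos_two_pi_mul δ, ← abs_of_pos Real.two_pi_pos, ← abs_mul,
      Real.cos_abs] at hcos
    have hpow : (Real.cos (Real.pi * δ) ^ 2) ^ m ≤ 1 := pow_le_one₀ hc0.le (Real.cos_sq_le_one _)
    calc 2 * (Real.cos (Real.pi * δ) ^ 2) ^ m * |_|
        ≤ 2 * 1 * Real.exp (m * (9 * δ)) := by
          gcongr
          exact abs_eval_chebyshev_T_le_exp_of_le_cos hδ hδ' hcos m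
      _ = _ := by rw [mul_one]

lemma sq_two_mul_exp (x : ℝ) : (2 * Real.exp x) ^ 2 = 4 * Real.exp (2 * x) := by
  rw [mul_pow, ← Real.exp_nat_mul]; norm_num

namespace IsDeepProfile

variable {h : ℝ → ℝ}

lemma le_neg_log_szegoError_of_gap (hh : IsDeepProfile h) {n : ℕ} {δ : ℝ}
    (hδ : 0 < δ) (hδ' : δ ≤ 1 / 4) (hn : 10 * (n * δ) ≤ h δ) :
    2 * (n * δ ^ 2) - 3 ≤ -Real.log (szegoError (deepZeroMeasure h) n) := by
  obtain ⟨Q, hQ, hQdeg, hoff, hon⟩ := exists_monic_small_off_arc (n / 2) hδ.le hδ'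
  have hmle : ((n / 2 : ℕ) : ℝ) ≤ n / 2 := Nat.cast_div_le
  have hmge : (n : ℝ) ≤ 2 * ((n / 2 : ℕ) : ℝ) + 1 := by
    exact_mod_cast (by omega : n ≤ 2 * (n / 2) + 1)
  set m := n / 2
  have hbound : 4 * Real.exp (-(8 * (m * δ ^ 2))) ≤ Real.exp (-(2 * (2 * (n * δ ^ 2) - 3))) := by
    have h4 : (4 : ℝ) ≤ Real.exp 3 := by linarith [Real.add_one_le_exp 3]
    calc 4 * Real.exp (-(8 * (m * δ ^ 2)))
        ≤ Real.exp 3 * Real.exp (-(8 * (m * δ ^ 2))) := by gcongr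
      _ = Real.exp (3 + -(8 * (m * δ ^ 2))) := (Real.exp_add _ _).symm
      _ ≤ _ := Real.exp_le_exp.2 (by nlinarith [mul_le_mul_of_nonneg_right hmge (sq_nonneg δ)])
  refine hh.le_neg_log_szegoError hQ (by omega) fun θ hθ => le_trans ?_ hbound
  rcases le_total δ |θ| with hθδ | hθδ
  · calc ‖Q.eval (circlePoint θ)‖ ^ 2 * Real.exp (-h |θ|)
        ≤ (2 * Real.exp (-(4 * (m * δ ^ 2)))) ^ 2 * 1 := by
          gcongr
          · exact hoff θ hθδ hθ.2
          · exact Real.exp_le_one_iff.2 (neg_nonpos.2 (hh.nonneg _ hθ))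
      _ = 4 * Real.exp (-(8 * (m * δ ^ 2))) := by rw [sq_two_mul_exp]; ring_nf
  · calc ‖Q.eval (circlePoint θ)‖ ^ 2 * Real.exp (-h |θ|)
        ≤ (2 * Real.exp (m * (9 * δ))) ^ 2 * Real.exp (-h δ) := by
          gcongr
          · exact hon θ hθδ
          · exact hh.anti hθ ⟨hδ, by linarith⟩ hθδ
      _ = 4 * Real.exp (2 * (m * (9 * δ)) + -h δ) := by
        rw [sq_two_mul_exp, mul_assoc, ← Real.exp_add]
      _ ≤ _ := by
        have hmδ : (m : ℝ) * δ ≤ n / 2 * δ := by gcongr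
        have hmδ2 : (m : ℝ) * δ ^ 2 ≤ m * δ * (1 / 4) := by
          rw [sq, ← mul_assoc]; gcongr
        gcongr
        nlinarith

end IsDeepProfile

/-! ### Test polynomials built from Fejér kernels -/

lemma norm_eval_reflect_circlePoint {f : ℂ[X]} {n : ℕ} (hf : f.natDegree ≤ n) (θ : ℝ) :
    ‖(f.reflect n).eval (circlePoint θ)‖ = ‖f.eval (circlePoint (-θ))‖ := by
  have hinv : (circlePoint (-θ))⁻¹ = circlePoint θ := inv_eq_of_mul_eq_one_left (by
    rw [← circlePoint_add, add_neg_cancel]; simp [circlePoint])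
  let _ : Invertible (circlePoint (-θ)) := invertibleOfNonzero (by rw [← norm_pos_iff]; simp)
  have hreflect := congrArg norm (eval₂_reflect_mul_pow (RingHom.id ℂ) (circlePoint (-θ)) n f hf)
  rwa [invOf_eq_inv, hinv, norm_mul, norm_pow, norm_circlePoint, one_pow, mul_one] at hreflect

lemma monic_inv_coeff_zero_mul_reflect {K : Type*} [Field K] {f : K[X]} {n : ℕ}
    (hf : f.natDegree ≤ n) (h0 : f.coeff 0 ≠ 0) :
    (C (f.coeff 0)⁻¹ * f.reflect n).Monic ∧ (C (f.coeff 0)⁻¹ * f.reflect n).natDegree ≤ n := by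
  have hcoeff : (f.reflect n).coeff n = f.coeff 0 := by
    rw [coeff_reflect, revAt_le le_rfl, Nat.sub_self]
  have hdeg : (f.reflect n).natDegree ≤ n := natDegree_reflect_le.trans (by simp [hf])
  have hdeg' := (natDegree_C_mul_le (f.coeff 0)⁻¹ (f.reflect n)).trans hdeg
  refine ⟨monic_of_natDegree_le_of_coeff_eq_one n hdeg' ?_, hdeg'⟩
  rw [coeff_C_mul, hcoeff, inv_mul_cancel₀ h0]

lemma IsDeepProfile.le_neg_log_szegoError_of_coeff_zero {h : ℝ → ℝ} (hh : IsDeepProfile h)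
    {f : ℂ[X]} {n : ℕ} (hf : f.natDegree ≤ n) (h0 : f.coeff 0 ≠ 0) {x : ℝ}
    (H : ∀ θ : ℝ, |θ| ∈ Set.Ioc (0 : ℝ) (1 / 2) →
      ‖f.eval (circlePoint θ)‖ ^ 2 * Real.exp (-h |θ|) ≤
        ‖f.coeff 0‖ ^ 2 * Real.exp (-(2 * x))) :
    x ≤ -Real.log (szegoError (deepZeroMeasure h) n) := by
  obtain ⟨hmonic, hdeg⟩ := monic_inv_coeff_zero_mul_reflect hf h0
  refine hh.le_neg_log_szegoError hmonic hdeg fun θ hθ => ?_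
  have hneg := H (-θ) (by rwa [abs_neg])
  rw [abs_neg] at hneg
  rwa [eval_mul, eval_C, norm_mul, mul_pow, norm_eval_reflect_circlePoint hf, norm_inv, inv_pow,
    mul_assoc, inv_mul_le_iff₀ (by positivity)]

lemma norm_one_add_sq_le_exp (w : ℂ) : ‖1 + w‖ ^ 2 ≤ Real.exp (2 * w.re + ‖w‖ ^ 2) := by
  have hexpand : ‖1 + w‖ ^ 2 = 2 * w.re + ‖w‖ ^ 2 + 1 := by
    rw [Complex.sq_norm, Complex.sq_norm, Complex.normSq_apply, Complex.normSq_apply]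
    simp only [Complex.add_re, Complex.one_re, Complex.add_im, Complex.one_im]
    ring
  rw [hexpand]
  exact Real.add_one_le_exp _

lemma norm_one_add_div_pow_sq_le_exp (w : ℂ) {N : ℕ} (hN : 0 < N) :
    ‖(1 + w / N) ^ N‖ ^ 2 ≤ Real.exp (2 * w.re + ‖w‖ ^ 2 / N) := by
  have hN' : (N : ℝ) ≠ 0 := Nat.cast_ne_zero.2 hN.ne'
  calc ‖(1 + w / N) ^ N‖ ^ 2 = (‖1 + w / N‖ ^ 2) ^ N := by rw [norm_pow, pow_right_comm]
    _ ≤ Real.exp (2 * (w / N).re + ‖w / N‖ ^ 2) ^ N := by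
        gcongr
        exact norm_one_add_sq_le_exp _
    _ = Real.exp (2 * w.re + ‖w‖ ^ 2 / N) := by
        rw [← Real.exp_nat_mul, Complex.div_natCast_re, norm_div, Complex.norm_natCast]
        congr 1
        field_simp

lemma exp_sub_sq_div_two_le_one_add {x : ℝ} (hx : 0 ≤ x) : Real.exp (x - x ^ 2 / 2) ≤ 1 + x := by
  have hfrac : x - x ^ 2 / 2 ≤ 2 * x / (x + 2) := by
    rw [le_div_iff₀ (by linarith)]
    nlinarith [pow_nonneg hx 3]
  exact (Real.le_log_iff_exp_le (by linarith)).1 (hfrac.trans (Real.le_log_one_add_of_nonneg hx))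

lemma exp_sub_sq_div_le_one_add_div_pow_sq {x : ℝ} (hx : 0 ≤ x) {N : ℕ} (hN : 0 < N) :
    Real.exp (2 * x - x ^ 2 / N) ≤ ((1 + x / N) ^ N) ^ 2 := by
  have hN' : (N : ℝ) ≠ 0 := Nat.cast_ne_zero.2 hN.ne'
  calc Real.exp (2 * x - x ^ 2 / N) = (Real.exp (x / N - (x / N) ^ 2 / 2) ^ N) ^ 2 := by
        rw [← pow_mul, ← Real.exp_nat_mul]
        push_cast
        congr 1
        field_simp
    _ ≤ ((1 + x / N) ^ N) ^ 2 := by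
        gcongr
        exact exp_sub_sq_div_two_le_one_add (by positivity)

-- `(1 + W / N) ^ N` is a polynomial substitute for the outer function `e ^ W`.
lemma IsDeepProfile.le_neg_log_szegoError_of_re_le {h : ℝ → ℝ} (hh : IsDeepProfile h) {n N : ℕ}
    (hN : 0 < N) {W : ℂ[X]} (hn : N * W.natDegree ≤ n) {S C₁ C₂ : ℝ} (hS : 0 ≤ S)
    (hW0 : W.coeff 0 = S)
    (hre : ∀ θ : ℝ, |θ| ∈ Set.Ioc (0 : ℝ) (1 / 2) →
      (W.eval (circlePoint θ)).re ≤ h |θ| / 2 + C₁)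
    (hnorm : ∀ z : ℂ, ‖z‖ ≤ 1 → ‖W.eval z‖ ^ 2 ≤ C₂ * N) :
    S - C₁ - C₂ ≤ -Real.log (szegoError (deepZeroMeasure h) n) := by
  have hN' : (0 : ℝ) < N := Nat.cast_pos.2 hN
  set f : ℂ[X] := (1 + C (N : ℂ)⁻¹ * W) ^ N with hf
  have hfeval : ∀ z, f.eval z = (1 + W.eval z / N) ^ N := fun z => by
    rw [hf, eval_pow, eval_add, eval_one, eval_mul, eval_C, inv_mul_eq_div]
  have hf0 : f.coeff 0 = (((1 + S / N) ^ N : ℝ) : ℂ) := by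
    rw [coeff_zero_eq_eval_zero, hfeval, ← coeff_zero_eq_eval_zero, hW0]
    push_cast
    rfl
  have hfdeg : f.natDegree ≤ n := by
    refine natDegree_pow_le.trans ((Nat.mul_le_mul_left N ?_).trans hn)
    exact (natDegree_add_le _ _).trans (by simpa using natDegree_C_mul_le _ W)
  have hlower : Real.exp (2 * S - C₂) ≤ ‖f.coeff 0‖ ^ 2 := by
    have hS2 := hnorm 0 (by simp)
    rw [← coeff_zero_eq_eval_zero, hW0, Complex.norm_real, Real.norm_of_nonneg hS,
      ← div_le_iff₀ hN'] at hS2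
    rw [hf0, Complex.norm_real, Real.norm_of_nonneg (by positivity)]
    exact (Real.exp_le_exp.2 (by linarith)).trans (exp_sub_sq_div_le_one_add_div_pow_sq hS hN)
  refine hh.le_neg_log_szegoError_of_coeff_zero hfdeg (by
    rw [hf0]; exact_mod_cast (by positivity : (1 + S / N : ℝ) ^ N ≠ 0)) fun θ hθ => ?_
  have hupper : ‖f.eval (circlePoint θ)‖ ^ 2 ≤ Real.exp (h |θ| + 2 * C₁ + C₂) := by
    have hθ2 := hnorm _ (norm_circlePoint θ).le
    rw [← div_le_iff₀ hN'] at hθ2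
    rw [hfeval]
    exact (norm_one_add_div_pow_sq_le_exp _ hN).trans (Real.exp_le_exp.2 (by linarith [hre θ hθ]))
  calc ‖f.eval (circlePoint θ)‖ ^ 2 * Real.exp (-h |θ|)
      ≤ Real.exp (h |θ| + 2 * C₁ + C₂) * Real.exp (-h |θ|) := by gcongr
    _ = Real.exp (2 * S - C₂) * Real.exp (-(2 * (S - C₁ - C₂))) := by
        rw [← Real.exp_add, ← Real.exp_add]
        ring_nf
    _ ≤ ‖f.coeff 0‖ ^ 2 * Real.exp (-(2 * (S - C₁ - C₂))) := by gcongr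

/-- The analytic Dirichlet sum `1 + 2 ∑_{1 ≤ j ≤ e} z^j`, whose real part on the unit circle is
the Dirichlet kernel. -/
noncomputable def dirichletPoly (e : ℕ) : ℂ[X] := 1 + ∑ j ∈ Finset.range e, C 2 * X ^ (j + 1)

/-- `d` times the analytic polynomial of degree less than `d` whose real part on the unit circle is
the `d`-th Fejér kernel. -/
noncomputable def fejerPoly (d : ℕ) : ℂ[X] := ∑ e ∈ Finset.range d, dirichletPoly e

lemma natDegree_fejerPoly_le (d : ℕ) : (fejerPoly d).natDegree ≤ d := by
  refine natDegree_sum_le_of_forall_le _ _ fun e he => (natDegree_add_le _ _).trans ?_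
  rw [natDegree_one, max_eq_right (Nat.zero_le _)]
  refine natDegree_sum_le_of_forall_le _ _ fun j hj => (natDegree_C_mul_X_pow_le _ _).trans ?_
  simp only [Finset.mem_range] at he hj
  omega

lemma coeff_zero_fejerPoly (d : ℕ) : (fejerPoly d).coeff 0 = d := by
  simp [fejerPoly, dirichletPoly]

lemma fejerPoly_succ (d : ℕ) : fejerPoly (d + 1) = fejerPoly d + dirichletPoly d := by
  rw [fejerPoly, Finset.sum_range_succ, fejerPoly]

lemma eval_dirichletPoly (e : ℕ) (z : ℂ) :
    (dirichletPoly e).eval z = 1 + 2 * (z * ∑ j ∈ Finset.range e, z ^ j) := by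
  rw [dirichletPoly, eval_add, eval_one, eval_finsetSum, Finset.mul_sum, Finset.mul_sum]
  simp [pow_succ']

lemma norm_geom_sum_le {z : ℂ} (hz : ‖z‖ ≤ 1) (d : ℕ) : ‖∑ j ∈ Finset.range d, z ^ j‖ ≤ d := by
  calc ‖∑ j ∈ Finset.range d, z ^ j‖ ≤ ∑ _j ∈ Finset.range d, (1 : ℝ) :=
        norm_sum_le_of_le _ fun j _ => (norm_pow_le z j).trans (pow_le_one₀ (norm_nonneg z) hz)
    _ = d := by simp

lemma norm_eval_fejerPoly_le (d : ℕ) {z : ℂ} (hz : ‖z‖ ≤ 1) :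
    ‖(fejerPoly d).eval z‖ ≤ (d : ℝ) ^ 2 := by
  induction d with
  | zero => simp [fejerPoly]
  | succ d ih =>
    have hdirichlet : ‖(dirichletPoly d).eval z‖ ≤ 1 + 2 * d := by
      rw [eval_dirichletPoly]
      refine (norm_add_le _ _).trans ?_
      rw [norm_one, norm_mul, norm_mul, Complex.norm_two]
      have := mul_le_mul hz (norm_geom_sum_le hz d) (norm_nonneg _) zero_le_one
      linarith
    rw [fejerPoly_succ, eval_add]
    push_cast
    linarith [norm_add_le ((fejerPoly d).eval z) ((dirichletPoly d).eval z)]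

lemma re_eval_fejerPoly (d : ℕ) {z : ℂ} (hz : ‖z‖ = 1) :
    ((fejerPoly d).eval z).re = ‖∑ j ∈ Finset.range d, z ^ j‖ ^ 2 := by
  induction d with
  | zero => simp [fejerPoly]
  | succ d ih =>
    rw [fejerPoly_succ, eval_add, Complex.add_re, ih, geom_sum_succ, eval_dirichletPoly]
    set G := ∑ j ∈ Finset.range d, z ^ j
    have hG : ‖G‖ = ‖z * G‖ := by rw [norm_mul, hz, one_mul]
    rw [hG, Complex.sq_norm, Complex.sq_norm, Complex.normSq_apply, Complex.normSq_apply]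
    simp only [Complex.add_re, Complex.one_re, Complex.add_im, Complex.one_im,
      Complex.mul_re (2 : ℂ), Complex.re_ofNat, Complex.im_ofNat]
    ring

lemma four_mul_abs_le_norm_circlePoint_sub_one {θ : ℝ} (hθ : |θ| ≤ 1 / 2) :
    4 * |θ| ≤ ‖circlePoint θ - 1‖ := by
  have hpi := Real.pi_pos
  have hsin := Real.mul_abs_le_abs_sin (x := Real.pi * θ) (by
    rw [abs_mul, abs_of_pos hpi]; nlinarith)
  rw [abs_mul, abs_of_pos hpi, ← mul_assoc, div_mul_cancel₀ _ hpi.ne'] at hsin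
  rw [circlePoint_eq_exp, mul_comm _ Complex.I, Complex.norm_exp_I_mul_ofReal_sub_one, norm_mul,
    Real.norm_ofNat, Real.norm_eq_abs, show 2 * Real.pi * θ / 2 = Real.pi * θ by ring]
  linarith

lemma norm_geom_sum_circlePoint_mul_le (d : ℕ) {θ : ℝ} (hθ : |θ| ≤ 1 / 2) :
    ‖∑ j ∈ Finset.range d, circlePoint θ ^ j‖ * (2 * |θ|) ≤ 1 := by
  have hgeom : ‖∑ j ∈ Finset.range d, circlePoint θ ^ j‖ * ‖circlePoint θ - 1‖ ≤ 2 := by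
    rw [← norm_mul, geom_sum_mul]
    refine (norm_sub_le _ _).trans_eq ?_
    rw [norm_pow, norm_circlePoint, one_pow, norm_one, one_add_one_eq_two]
  linarith [mul_le_mul_of_nonneg_left (four_mul_abs_le_norm_circlePoint_sub_one hθ)
    (norm_nonneg (∑ j ∈ Finset.range d, circlePoint θ ^ j))]

lemma re_eval_fejerPoly_div_le {d : ℕ} (hd : 0 < d) {θ : ℝ}
    (hθ : |θ| ∈ Set.Ioc (0 : ℝ) (1 / 2)) :
    ((fejerPoly d).eval (circlePoint θ)).re / d ≤ min (d : ℝ) (1 / (4 * d * |θ| ^ 2)) := by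
  have hd' : (0 : ℝ) < d := Nat.cast_pos.2 hd
  have hθ0 := hθ.1
  rw [re_eval_fejerPoly d (norm_circlePoint θ)]
  refine le_min ?_ ?_
  · rw [div_le_iff₀ hd', ← sq]
    exact pow_le_pow_left₀ (norm_nonneg _) (norm_geom_sum_le (norm_circlePoint θ).le d) 2
  · have hsq := pow_le_pow_left₀ (by positivity) (norm_geom_sum_circlePoint_mul_le d hθ.2) 2
    rw [div_le_div_iff₀ hd' (by positivity)]
    nlinarith

/-- `∑_{1 ≤ k ≤ K} b_k F_{2^k}`, where `F_d` is the analytic polynomial whose real part on the unit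
circle is the `d`-th Fejér kernel. Its value at `0` is `∑ b_k`. -/
noncomputable def dyadicFejerSum (b : ℕ → ℝ) (K : ℕ) : ℂ[X] :=
  ∑ k ∈ Finset.Icc 1 K, C ((b k / 2 ^ k : ℝ) : ℂ) * fejerPoly (2 ^ k)

lemma natDegree_dyadicFejerSum_le (b : ℕ → ℝ) (K : ℕ) :
    (dyadicFejerSum b K).natDegree ≤ 2 ^ K :=
  natDegree_sum_le_of_forall_le _ _ fun _ hk => (natDegree_C_mul_le _ _).trans
    ((natDegree_fejerPoly_le _).trans
      (Nat.pow_le_pow_right (by norm_num) (Finset.mem_Icc.1 hk).2))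

lemma coeff_zero_dyadicFejerSum (b : ℕ → ℝ) (K : ℕ) :
    (dyadicFejerSum b K).coeff 0 = ((∑ k ∈ Finset.Icc 1 K, b k : ℝ) : ℂ) := by
  rw [dyadicFejerSum, finsetSum_coeff, Complex.ofReal_sum]
  refine Finset.sum_congr rfl fun k _ => ?_
  rw [coeff_C_mul, coeff_zero_fejerPoly]
  push_cast
  field_simp

lemma eval_dyadicFejerSum (b : ℕ → ℝ) (K : ℕ) (z : ℂ) : (dyadicFejerSum b K).eval z =
    ∑ k ∈ Finset.Icc 1 K, ((b k / 2 ^ k : ℝ) : ℂ) * (fejerPoly (2 ^ k)).eval z := by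
  rw [dyadicFejerSum, eval_finsetSum]
  simp only [eval_mul, eval_C]

lemma norm_eval_dyadicFejerSum_le {b : ℕ → ℝ} (hb : ∀ k, 0 ≤ b k) (K : ℕ) {z : ℂ} (hz : ‖z‖ ≤ 1) :
    ‖(dyadicFejerSum b K).eval z‖ ≤ ∑ k ∈ Finset.Icc 1 K, b k * 2 ^ k := by
  rw [eval_dyadicFejerSum]
  refine norm_sum_le_of_le _ fun k _ => ?_
  have hbk : 0 ≤ b k / 2 ^ k := div_nonneg (hb k) (by positivity)
  have hfejer := mul_le_mul_of_nonneg_left (norm_eval_fejerPoly_le (2 ^ k) hz) hbk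
  rw [norm_mul, Complex.norm_real, Real.norm_of_nonneg hbk]
  refine hfejer.trans_eq ?_
  push_cast
  field_simp

lemma re_eval_dyadicFejerSum_le {b : ℕ → ℝ} (hb : ∀ k, 0 ≤ b k) (K : ℕ) {θ : ℝ}
    (hθ : |θ| ∈ Set.Ioc (0 : ℝ) (1 / 2)) : ((dyadicFejerSum b K).eval (circlePoint θ)).re ≤
      ∑ k ∈ Finset.Icc 1 K, b k * min ((2 : ℝ) ^ k) (1 / (4 * 2 ^ k * |θ| ^ 2)) := by
  rw [eval_dyadicFejerSum, Complex.re_sum]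
  refine Finset.sum_le_sum fun k _ => ?_
  have hfejer := re_eval_fejerPoly_div_le (d := 2 ^ k) (by positivity) hθ
  push_cast at hfejer
  rw [Complex.re_ofReal_mul, div_mul_comm, mul_comm]
  exact mul_le_mul_of_nonneg_left hfejer (hb k)

lemma IsDeepProfile.le_neg_log_szegoError_of_fejer_sum {h : ℝ → ℝ} (hh : IsDeepProfile h)
    {n K N : ℕ} (hN : 0 < N) (hn : N * 2 ^ K ≤ n) {b : ℕ → ℝ} (hb : ∀ k, 0 ≤ b k) {C₁ C₂ : ℝ}
    (hminor : ∀ θ ∈ Set.Ioc (0 : ℝ) (1 / 2), ∑ k ∈ Finset.Icc 1 K,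
      b k * min ((2 : ℝ) ^ k) (1 / (4 * 2 ^ k * θ ^ 2)) ≤ h θ / 2 + C₁)
    (hsq : (∑ k ∈ Finset.Icc 1 K, b k * 2 ^ k) ^ 2 ≤ C₂ * N) :
    ∑ k ∈ Finset.Icc 1 K, b k - C₁ - C₂ ≤ -Real.log (szegoError (deepZeroMeasure h) n) :=
  hh.le_neg_log_szegoError_of_re_le hN
    ((Nat.mul_le_mul_left N (natDegree_dyadicFejerSum_le b K)).trans hn)
    (Finset.sum_nonneg fun k _ => hb k) (coeff_zero_dyadicFejerSum b K)
    (fun θ hθ => (re_eval_dyadicFejerSum_le hb K hθ).trans (hminor |θ| hθ))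
    fun _ hz =>
      (pow_le_pow_left₀ (norm_nonneg _) (norm_eval_dyadicFejerSum_le hb K hz) 2).trans hsq

/-! ### Uniform comparison with a sequence of rates -/

lemma exists_pos_mul_le_of_sub_le {r : ℕ → ℝ} {l₀ k₁ B : ℝ} (hl₀ : 0 < l₀) (hk₁ : 0 < k₁) (N : ℕ) :
    ∃ k : ℝ, 0 < k ∧ ∀ L : ℕ → ℝ, (∀ n, l₀ ≤ L n) → (∀ n, N ≤ n → k₁ * r n - B ≤ L n) →
      ∀ n, k * r n ≤ L n := by
  obtain ⟨R, hR⟩ := ((Set.finite_lt_nat N).image r).bddAbove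
  set B' := max 0 (max B (k₁ * R))
  have hfactor : 0 < 1 + B' / l₀ :=
    add_pos_of_pos_of_nonneg one_pos (div_nonneg (le_max_left _ _) hl₀.le)
  refine ⟨k₁ / (1 + B' / l₀), div_pos hk₁ hfactor, fun L hL hLr n => ?_⟩
  have hbound : k₁ * r n ≤ L n + B' := by
    rcases lt_or_ge n N with hn | hn
    · have hrn : k₁ * r n ≤ k₁ * R :=
        mul_le_mul_of_nonneg_left (hR (Set.mem_image_of_mem r hn)) hk₁.le
      have hB : k₁ * R ≤ B' := (le_max_right B _).trans (le_max_right 0 _)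
      linarith [hL n]
    · have hB : B ≤ B' := (le_max_left _ (k₁ * R)).trans (le_max_right 0 _)
      linarith [hLr n hn]
  have habsorb : B' ≤ L n * (B' / l₀) :=
    calc B' = l₀ * (B' / l₀) := (mul_div_cancel₀ B' hl₀.ne').symm
      _ ≤ L n * (B' / l₀) := by gcongr; exact hL n
  rw [div_mul_eq_mul_div, div_le_iff₀ hfactor]
  linarith

lemma exists_pos_le_mul_of_le_add {r : ℕ → ℝ} {r₀ K₁ B : ℝ} {n₀ : ℕ} (hr₀ : 0 < r₀)
    (hr : ∀ n, n₀ ≤ n → r₀ ≤ r n) (N : ℕ) :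
    ∃ K : ℝ, 0 < K ∧ ∀ L : ℕ → ℝ, Monotone L → (∀ n, N ≤ n → L n ≤ K₁ * r n + B) →
      ∀ n, n₀ ≤ n → L n ≤ K * r n := by
  set B' := max 1 (max B (K₁ * r N + B))
  have hB' : 0 < B' := one_pos.trans_le (le_max_left _ _)
  have hK : 0 < |K₁| + B' / r₀ := add_pos_of_nonneg_of_pos (abs_nonneg _) (div_pos hB' hr₀)
  refine ⟨|K₁| + B' / r₀, hK, fun L hL hLr n hn => ?_⟩
  have hrn : 0 < r n := hr₀.trans_le (hr n hn)
  have hbound : L n ≤ |K₁| * r n + B' := by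
    rcases le_total N n with hNn | hNn
    · have hB : B ≤ B' := (le_max_left _ _).trans (le_max_right _ _)
      have hK : K₁ * r n ≤ |K₁| * r n := mul_le_mul_of_nonneg_right (le_abs_self _) hrn.le
      linarith [hLr n hNn]
    · have hB : K₁ * r N + B ≤ B' := (le_max_right _ _).trans (le_max_right _ _)
      have hK : 0 ≤ |K₁| * r n := by positivity
      linarith [hL hNn, hLr N le_rfl]
  have habsorb : B' ≤ B' / r₀ * r n :=
    calc B' = B' / r₀ * r₀ := (div_mul_cancel₀ B' hr₀.ne').symm
      _ ≤ B' / r₀ * r n := by gcongr; exact hr n hn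
  linarith

lemma exists_pos_forall_le_of_tendsto {r : ℕ → ℝ} {n₀ : ℕ} (hr : ∀ n, n₀ ≤ n → 0 < r n)
    (ht : Tendsto r atTop atTop) : ∃ r₀ : ℝ, 0 < r₀ ∧ ∀ n, n₀ ≤ n → r₀ ≤ r n := by
  have hshift : Tendsto (fun n => r (n + n₀)) cofinite atTop := by
    rw [Nat.cofinite_eq_atTop]
    exact ht.comp (tendsto_add_atTop_nat n₀)
  obtain ⟨m, hm⟩ := hshift.exists_forall_le
  refine ⟨r (m + n₀), hr _ (Nat.le_add_left _ _), fun n hn => ?_⟩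
  simpa only [Nat.sub_add_cancel hn] using hm (n - n₀)

namespace IsDeepProfile

variable {h : ℝ → ℝ} {δ : ℝ}

lemma energy_one_le (hh : IsDeepProfile h) (hδ : 0 < δ) (hδ' : δ ≤ 1 / 2) :
    energy h 1 ≤ 1 - 2 * δ * (1 - Real.exp (-h δ)) := by
  have hsymmSq : ∀ θ, symmSq 1 θ = 2 := fun θ => by norm_num [symmSq]
  have hIntegrable := hh.intervalIntegrable_mul_exp_neg (f := fun _ => 2) continuous_const
  have hmem : δ ∈ Set.uIcc (0 : ℝ) (1 / 2) := Set.mem_uIcc_of_le hδ.le hδ'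
  have hleft := hIntegrable.mono_set (Set.uIcc_subset_uIcc Set.left_mem_uIcc hmem)
  have hright := hIntegrable.mono_set (Set.uIcc_subset_uIcc hmem Set.right_mem_uIcc)
  have hnear : ∫ θ in 0..δ, 2 * Real.exp (-h θ) ≤ ∫ _ in 0..δ, 2 * Real.exp (-h δ) := by
    refine intervalIntegral.integral_mono_on_of_le_Ioo hδ.le hleft (by simp) fun θ hθ => ?_
    gcongr
    exact hh.anti ⟨hθ.1, hθ.2.le.trans hδ'⟩ ⟨hδ, hδ'⟩ hθ.2.le
  have hfar : ∫ θ in δ..(1 / 2), 2 * Real.exp (-h θ) ≤ ∫ _ in δ..(1 / 2), 2 := by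
    refine intervalIntegral.integral_mono_on hδ' hright (by simp) fun θ hθ => ?_
    have hexp := Real.exp_le_one_iff.2 (neg_nonpos.2 (hh.nonneg _ ⟨hδ.trans_le hθ.1, hθ.2⟩))
    linarith
  simp only [energy, hsymmSq]
  rw [← intervalIntegral.integral_add_adjacent_intervals hleft hright]
  rw [intervalIntegral.integral_const, smul_eq_mul] at hnear hfar
  linarith

lemma neg_log_le_neg_log_szegoError (hh : IsDeepProfile h) (hδ : 0 < δ) (hδ' : δ ≤ 1 / 2) (n : ℕ) :
    -(Real.log (1 - 2 * δ * (1 - Real.exp (-h δ))) / 2) ≤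
      -Real.log (szegoError (deepZeroMeasure h) n) := by
  have hpos : 0 < 1 - 2 * δ * (1 - Real.exp (-h δ)) := by nlinarith [Real.exp_pos (-h δ)]
  rw [neg_le_neg_iff, ← Real.log_sqrt hpos.le]
  refine Real.log_le_log (hh.szegoError_pos n) ?_
  exact (hh.szegoError_le_of_natDegree_le monic_one (by simp)).trans
    (Real.sqrt_le_sqrt (hh.energy_one_le hδ hδ'))

end IsDeepProfile

lemma exists_pos_le_neg_log_szegoError {a δ : ℝ} (ha : 0 < a) (hδ : 0 < δ) (hδ' : δ ≤ 1 / 2) :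
    ∃ l₀ : ℝ, 0 < l₀ ∧ ∀ h : ℝ → ℝ, IsDeepProfile h → a ≤ h δ → ∀ n,
      l₀ ≤ -Real.log (szegoError (deepZeroMeasure h) n) := by
  have hexp : Real.exp (-a) < 1 := Real.exp_lt_one_iff.2 (neg_neg_of_pos ha)
  have hpos : 0 < 1 - 2 * δ * (1 - Real.exp (-a)) := by nlinarith [Real.exp_pos (-a)]
  have hlt : 1 - 2 * δ * (1 - Real.exp (-a)) < 1 := by nlinarith
  refine ⟨-(Real.log (1 - 2 * δ * (1 - Real.exp (-a))) / 2), by linarith [Real.log_neg hpos hlt],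
    fun h hh hah n => le_trans ?_ (hh.neg_log_le_neg_log_szegoError hδ hδ' n)⟩
  have hmono : Real.exp (-h δ) ≤ Real.exp (-a) := Real.exp_le_exp.2 (neg_le_neg hah)
  have hpos' : 0 < 1 - 2 * δ * (1 - Real.exp (-h δ)) := by nlinarith [Real.exp_pos (-h δ)]
  gcongr

/-- The lower half of `HasDeepZeroRate g r`, up to an additive constant and for large `n`: a
lower bound `c g ≤ h` near `0` forces `|log e_n| ≥ k r n - B`, uniformly in `h`. -/
def HasLowerRate (g : ℝ → ℝ) (r : ℕ → ℝ) : Prop :=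
  ∀ c δ : ℝ, 0 < c → 0 < δ → δ ≤ 1 / 2 → ∃ k B : ℝ, 0 < k ∧ ∀ᶠ n in atTop,
    ∀ h : ℝ → ℝ, IsDeepProfile h → (∀ θ ∈ Set.Ioc 0 δ, c * g θ ≤ h θ) →
      k * r n - B ≤ -Real.log (szegoError (deepZeroMeasure h) n)

/-- The upper half of `HasDeepZeroRate g r`, up to an additive constant and for large `n`: an
upper bound `h ≤ C g` near `0` forces `|log e_n| ≤ K r n + B`, uniformly in `h`. -/
def HasUpperRate (g : ℝ → ℝ) (r : ℕ → ℝ) : Prop :=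
  ∀ C δ : ℝ, 0 < C → 0 < δ → δ ≤ 1 / 2 → ∃ K B : ℝ, ∀ᶠ n in atTop,
    ∀ h : ℝ → ℝ, IsDeepProfile h → (∀ θ ∈ Set.Ioc 0 δ, h θ ≤ C * g θ) →
      -Real.log (szegoError (deepZeroMeasure h) n) ≤ K * r n + B

lemma HasLowerRate.hasDeepZeroRate {g : ℝ → ℝ} {r : ℕ → ℝ} (hlower : HasLowerRate g r)
    (hupper : HasUpperRate g r) (hg : ∀ θ ∈ Set.Ioc (0 : ℝ) (1 / 2), 0 < g θ)
    (hr : ∀ n, 4 ≤ n → 0 < r n) (ht : Tendsto r atTop atTop) : HasDeepZeroRate g r := by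
  intro c C δ hc hC hδ hδ'
  obtain ⟨k₁, B₁, hk₁, hlow⟩ := hlower c δ hc hδ hδ'
  obtain ⟨K₁, B₂, hupp⟩ := hupper C δ hC hδ hδ'
  obtain ⟨N₁, hN₁⟩ := hlow.exists_forall_of_atTop
  obtain ⟨N₂, hN₂⟩ := hupp.exists_forall_of_atTop
  obtain ⟨l₀, hl₀, hl⟩ := exists_pos_le_neg_log_szegoError (mul_pos hc (hg δ ⟨hδ, hδ'⟩)) hδ hδ'
  obtain ⟨r₀, hr₀, hrr₀⟩ := exists_pos_forall_le_of_tendsto hr ht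
  obtain ⟨k, hk, hkr⟩ := exists_pos_mul_le_of_sub_le (r := r) (B := B₁) hl₀ hk₁ N₁
  obtain ⟨K, hK, hKr⟩ := exists_pos_le_mul_of_le_add (K₁ := K₁) (B := B₂) hr₀ hrr₀ N₂
  refine ⟨k, K, hk, hK, fun h hanti hnonneg hcomp n hn => ?_⟩
  have hh : IsDeepProfile h := ⟨hanti, hnonneg⟩
  have hmono : Monotone fun n => -Real.log (szegoError (deepZeroMeasure h) n) := fun _ m hnm =>
    neg_le_neg (Real.log_le_log (hh.szegoError_pos m) (hh.szegoError_antitone hnm))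
  have hL := hl h hh (hcomp δ ⟨hδ, le_rfl⟩).1
  simp only [abs_of_neg (neg_pos.1 (hl₀.trans_le (hL n)))]
  exact ⟨hkr _ hL (fun m hm => hN₁ m hm h hh fun θ hθ => (hcomp θ hθ).1) n,
    hKr _ hmono (fun m hm => hN₂ m hm h hh fun θ hθ => (hcomp θ hθ).2) n hn⟩

lemma IsDeepProfile.neg_log_szegoError_le_of_le {h : ℝ → ℝ} (hh : IsDeepProfile h) {g : ℝ → ℝ}
    {C δ : ℝ} (hδ' : δ ≤ 1 / 2) (hC : ∀ θ ∈ Set.Ioc 0 δ, h θ ≤ C * g θ) (n : ℕ)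
    {η : ℝ} (hη : 0 < η) (hη4 : η ≤ 1 / 4) (hηδ : η ≤ δ) (hg : IntervalIntegrable g volume η δ) :
    -Real.log (szegoError (deepZeroMeasure h) n) ≤
      3 + C * (η * g η) + 9 * (n * η ^ 2) + (C * (∫ θ in η..δ, g θ) + C * g δ) := by
  have hδ : 0 < δ := hη.trans_le hηδ
  have hδmem : δ ∈ Set.Ioc (0 : ℝ) (1 / 2) := ⟨hδ, hδ'⟩
  have hIntegrable := hh.intervalIntegrable hη (hηδ.trans hδ')
  have hmem : δ ∈ Set.uIcc η (1 / 2) := Set.mem_uIcc_of_le hηδ hδ'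
  have hleft := hIntegrable.mono_set (Set.uIcc_subset_uIcc Set.left_mem_uIcc hmem)
  have hright := hIntegrable.mono_set (Set.uIcc_subset_uIcc hmem Set.right_mem_uIcc)
  have hnear : ∫ θ in η..δ, h θ ≤ C * ∫ θ in η..δ, g θ := by
    rw [← intervalIntegral.integral_const_mul]
    exact intervalIntegral.integral_mono_on hηδ hleft (hg.const_mul C)
      fun θ hθ => hC θ ⟨hη.trans_le hθ.1, hθ.2⟩
  have hfar : ∫ θ in δ..(1 / 2), h θ ≤ C * g δ := by
    have hconst : ∫ θ in δ..(1 / 2), h θ ≤ ∫ _ in δ..(1 / 2), h δ :=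
      intervalIntegral.integral_mono_on hδ' hright (by simp)
        fun θ hθ => hh.anti hδmem ⟨hδ.trans_le hθ.1, hθ.2⟩ hθ.1
    rw [intervalIntegral.integral_const, smul_eq_mul] at hconst
    nlinarith [hC δ ⟨hδ, le_rfl⟩, hh.nonneg δ hδmem]
  have hheight : η * h η ≤ C * (η * g η) :=
    calc η * h η ≤ η * (C * g η) := by gcongr; exact hC η ⟨hη, hηδ⟩
      _ = C * (η * g η) := by ring
  refine (hh.neg_log_szegoError_le n hη hη4).trans ?_
  rw [← intervalIntegral.integral_add_adjacent_intervals hleft hright]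
  linarith

/-! ### Profiles growing like a power or an exponential of a power -/

lemma eventually_mem_Ioc_of_tendsto_zero {η : ℕ → ℝ} (hη : Tendsto η atTop (nhds 0))
    (hpos : ∀ᶠ n in atTop, 0 < η n) {u : ℝ} (hu : 0 < u) :
    ∀ᶠ n in atTop, η n ∈ Set.Ioc 0 u :=
  hpos.and (hη.eventually_le_const hu)

section RpowScale

variable {p a x : ℝ}

lemma rpow_neg_div_inv_rpow (hp : p + 1 ≠ 0) (ha : 0 < a) (hx : 0 < x) :
    ((a / x) ^ (p + 1)⁻¹) ^ (-p) = x / a * (a / x) ^ (p + 1)⁻¹ := by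
  have hax : 0 < a / x := div_pos ha hx
  have hexp : (p + 1)⁻¹ * -p = -1 + (p + 1)⁻¹ := by field_simp; ring
  rw [← Real.rpow_mul hax.le, hexp, Real.rpow_add hax, Real.rpow_neg_one, inv_div]

lemma mul_sq_div_rpow (hp : p + 1 ≠ 0) (ha : 0 < a) (hx : 0 < x) :
    x * ((a / x) ^ (p + 1)⁻¹) ^ 2 = a ^ (2 / (p + 1)) * x ^ ((p - 1) / (p + 1)) := by
  have hexp : (p - 1) / (p + 1) = 1 - 2 / (p + 1) := by field_simp; ring
  rw [← Real.rpow_natCast, ← Real.rpow_mul (div_pos ha hx).le, hexp, Real.rpow_sub hx,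
    Real.rpow_one, Real.div_rpow ha.le hx.le, Nat.cast_ofNat, inv_mul_eq_div]
  ring

lemma eventually_div_rpow_mem_Ioc (hp : 0 < p + 1) (ha : 0 < a) {u : ℝ} (hu : 0 < u) :
    ∀ᶠ n : ℕ in atTop, (a / n) ^ (p + 1)⁻¹ ∈ Set.Ioc 0 u := by
  refine eventually_mem_Ioc_of_tendsto_zero ?_ ?_ hu
  · have hlim := (tendsto_const_div_atTop_nhds_zero_nat a).rpow_const (p := (p + 1)⁻¹)
      (Or.inr (inv_nonneg.2 hp.le))
    rwa [Real.zero_rpow (inv_ne_zero hp.ne')] at hlim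
  · filter_upwards [eventually_gt_atTop 0] with n hn
    exact Real.rpow_pos_of_pos (div_pos ha (Nat.cast_pos.2 hn)) _

end RpowScale

lemma hasLowerRate_rpow {p : ℝ} (hp : 1 < p) :
    HasLowerRate (fun θ => θ ^ (-p)) (fun n => (n : ℝ) ^ ((p - 1) / (p + 1))) := by
  intro c δ hc hδ _
  have hp1 : 0 < p + 1 := by linarith
  refine ⟨2 * (c / 10) ^ (2 / (p + 1)), 3, by positivity, ?_⟩
  filter_upwards [eventually_div_rpow_mem_Ioc hp1 (a := c / 10) (by positivity)
    (u := min δ (1 / 4)) (by positivity), eventually_gt_atTop 0] with n hη hn h hh hgh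
  have hn' : (0 : ℝ) < n := Nat.cast_pos.2 hn
  have hsq := mul_sq_div_rpow hp1.ne' (a := c / 10) (by positivity) hn'
  have hgap := hgh _ ⟨hη.1, hη.2.trans (min_le_left _ _)⟩
  rw [rpow_neg_div_inv_rpow hp1.ne' (by positivity) hn'] at hgap
  have hlow := hh.le_neg_log_szegoError_of_gap (n := n) hη.1 (hη.2.trans (min_le_right _ _))
    (le_of_eq_of_le (by field_simp) hgap)
  rw [hsq] at hlow
  linarith

lemma integral_rpow_neg_le {p ν δ : ℝ} (hp : 1 < p) (hν : 0 < ν) (hνδ : ν ≤ δ) :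
    ∫ θ in ν..δ, θ ^ (-p) ≤ ν ^ (1 - p) / (p - 1) := by
  have hzero : (0 : ℝ) ∉ Set.uIcc ν δ := Set.notMem_uIcc_of_lt hν (hν.trans_le hνδ)
  have hδp : 0 ≤ δ ^ (1 - p) := Real.rpow_nonneg (hν.le.trans hνδ) _
  rw [integral_rpow (Or.inr ⟨by linarith, hzero⟩), neg_add_eq_sub, ← neg_div_neg_eq, neg_sub,
    neg_sub]
  gcongr
  linarith

lemma hasUpperRate_rpow {p : ℝ} (hp : 1 < p) :
    HasUpperRate (fun θ => θ ^ (-p)) (fun n => (n : ℝ) ^ ((p - 1) / (p + 1))) := by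
  intro C δ hC hδ hδ'
  have hp1 : 0 < p + 1 := by linarith
  refine ⟨C + 9 + C / (p - 1), 3 + C * δ ^ (-p), ?_⟩
  filter_upwards [eventually_div_rpow_mem_Ioc hp1 one_pos (u := min δ (1 / 4)) (by positivity),
    eventually_gt_atTop 0] with n hη hn h hh hgh
  have hn' : (0 : ℝ) < n := Nat.cast_pos.2 hn
  have hsq := mul_sq_div_rpow hp1.ne' one_pos hn'
  have hpow := rpow_neg_div_inv_rpow hp1.ne' one_pos hn'
  set η := (1 / (n : ℝ)) ^ (p + 1)⁻¹
  rw [Real.one_rpow, one_mul] at hsq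
  have hηδ : η ≤ δ := hη.2.trans (min_le_left _ _)
  have hzero : (0 : ℝ) ∉ Set.uIcc η δ := Set.notMem_uIcc_of_lt hη.1 hδ
  have hheight : η * η ^ (-p) = (n : ℝ) ^ ((p - 1) / (p + 1)) := by rw [hpow, ← hsq]; ring
  have hmean : ∫ θ in η..δ, θ ^ (-p) ≤ (n : ℝ) ^ ((p - 1) / (p + 1)) / (p - 1) := by
    rw [← hheight, ← Real.rpow_one_add' hη.1.le (by linarith), ← sub_eq_add_neg]
    exact integral_rpow_neg_le hp hη.1 hηδ
  have hupp := hh.neg_log_szegoError_le_of_le hδ' hgh n hη.1 (hη.2.trans (min_le_right _ _)) hηδ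
    (intervalIntegral.intervalIntegrable_rpow (Or.inr hzero))
  rw [hheight, hsq] at hupp
  calc _ ≤ _ := hupp
    _ ≤ 3 + C * (n : ℝ) ^ ((p - 1) / (p + 1)) + 9 * (n : ℝ) ^ ((p - 1) / (p + 1)) +
        (C * ((n : ℝ) ^ ((p - 1) / (p + 1)) / (p - 1)) + C * δ ^ (-p)) := by gcongr
    _ = _ := by ring

lemma hasDeepZeroRate_rpow {p : ℝ} (hp : 1 < p) :
    HasDeepZeroRate (fun θ => θ ^ (-p)) (fun n => (n : ℝ) ^ ((p - 1) / (p + 1))) :=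
  (hasLowerRate_rpow hp).hasDeepZeroRate (hasUpperRate_rpow hp)
    (fun _ hθ => Real.rpow_pos_of_pos hθ.1 _) (fun _ _ => Real.rpow_pos_of_pos (by positivity) _)
    ((tendsto_rpow_atTop (div_pos (by linarith) (by linarith))).comp tendsto_natCast_atTop_atTop)

lemma tendsto_log_natCast_atTop : Tendsto (fun n : ℕ => Real.log n) atTop atTop :=
  Real.tendsto_log_atTop.comp tendsto_natCast_atTop_atTop

section LogScale

variable {p b x : ℝ}

lemma exp_log_scale_rpow_neg (hp : p ≠ 0) (hb : 0 < b) (hx : 1 < x) :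
    Real.exp (((b * Real.log x) ^ (-p⁻¹)) ^ (-p)) = x ^ b := by
  have hlog : 0 < Real.log x := Real.log_pos hx
  rw [← Real.rpow_mul (by positivity), neg_mul_neg, inv_mul_cancel₀ hp, Real.rpow_one,
    Real.rpow_def_of_pos (by linarith), mul_comm]

lemma mul_sq_log_scale (hb : 0 < b) (hx : 1 < x) :
    x * ((b * Real.log x) ^ (-p⁻¹)) ^ 2 =
      b ^ (-2 / p) * (x * Real.log x ^ (-2 / p)) := by
  have hlog : 0 < Real.log x := Real.log_pos hx
  have hexp : -p⁻¹ * (2 : ℕ) = -2 / p := by push_cast; ring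
  rw [← Real.rpow_natCast, ← Real.rpow_mul (by positivity), Real.mul_rpow hb.le hlog.le, hexp]
  ring

lemma eventually_log_scale_mem_Ioc (hp : 0 < p) (hb : 0 < b) {u : ℝ} (hu : 0 < u) :
    ∀ᶠ n : ℕ in atTop, (b * Real.log n) ^ (-p⁻¹) ∈ Set.Ioc 0 u :=
  eventually_mem_Ioc_of_tendsto_zero
    ((tendsto_rpow_neg_atTop (inv_pos.2 hp)).comp (tendsto_log_natCast_atTop.const_mul_atTop hb))
    ((tendsto_log_natCast_atTop.eventually_gt_atTop 0).mono fun _ hn =>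
      Real.rpow_pos_of_pos (mul_pos hb hn) _) hu

end LogScale

lemma eventually_sqrt_le_mul_log_rpow (p : ℝ) :
    ∀ᶠ n : ℕ in atTop, (n : ℝ) ^ (1 / 2 : ℝ) ≤ n * Real.log n ^ (-2 / p) := by
  refine tendsto_natCast_atTop_atTop.eventually (p := fun x : ℝ =>
    x ^ (1 / 2 : ℝ) ≤ x * Real.log x ^ (-2 / p)) ?_
  have hlittleO := (isLittleO_log_rpow_rpow_atTop (2 / p) (s := 1 / 2) (by norm_num)).bound one_pos
  filter_upwards [hlittleO, eventually_gt_atTop 1] with x hx hx1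
  have hlog : 0 < Real.log x := Real.log_pos hx1
  have hx0 : 0 < x := by linarith
  rw [Real.norm_of_nonneg (by positivity), Real.norm_of_nonneg (by positivity), one_mul] at hx
  rw [neg_div, Real.rpow_neg hlog.le, ← div_eq_mul_inv, le_div_iff₀ (by positivity)]
  calc x ^ (1 / 2 : ℝ) * Real.log x ^ (2 / p) ≤ x ^ (1 / 2 : ℝ) * x ^ (1 / 2 : ℝ) := by gcongr
    _ = x := by rw [← Real.rpow_add hx0]; norm_num

lemma tendsto_mul_log_rpow_atTop (p : ℝ) :
    Tendsto (fun n : ℕ => (n : ℝ) * Real.log n ^ (-2 / p)) atTop atTop :=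
  tendsto_atTop_mono' _ (eventually_sqrt_le_mul_log_rpow p)
    ((tendsto_rpow_atTop one_half_pos).comp tendsto_natCast_atTop_atTop)

-- At `η = (2 log n)^{-1/p}` the profile `exp (θ ^ (-p))` equals `n²`, well above `10 n η`.
lemma hasLowerRate_exp_rpow {p : ℝ} (hp : 0 < p) :
    HasLowerRate (fun θ => Real.exp (θ ^ (-p))) (fun n => n * Real.log n ^ (-2 / p)) := by
  intro c δ hc hδ _
  refine ⟨2 * 2 ^ (-2 / p), 3, by positivity, ?_⟩
  filter_upwards [eventually_log_scale_mem_Ioc hp two_pos (u := min δ (1 / 4)) (by positivity),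
    eventually_gt_atTop 1, tendsto_natCast_atTop_atTop.eventually_ge_atTop (10 / c)]
    with n hη hn hnc h hh hgh
  have hn' : (1 : ℝ) < n := Nat.one_lt_cast.2 hn
  have hsq := mul_sq_log_scale (p := p) two_pos hn'
  have hgap := hgh _ ⟨hη.1, hη.2.trans (min_le_left _ _)⟩
  rw [exp_log_scale_rpow_neg hp.ne' two_pos hn', Real.rpow_two] at hgap
  set η := (2 * Real.log (n : ℝ)) ^ (-p⁻¹)
  have hη4 : η ≤ 1 / 4 := hη.2.trans (min_le_right _ _)
  rw [div_le_iff₀ hc] at hnc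
  have hheight : 10 * (n * η) ≤ c * (n : ℝ) ^ 2 :=
    calc 10 * (n * η) ≤ 10 * (n * 1) := by gcongr; linarith
      _ = n * 10 := by ring
      _ ≤ n * (n * c) := by gcongr
      _ = c * (n : ℝ) ^ 2 := by ring
  have hlow := hh.le_neg_log_szegoError_of_gap hη.1 hη4 (hheight.trans hgap)
  rw [hsq] at hlow
  linarith

-- At `η = (log n / 2)^{-1/p}` the profile equals `√n`, which is `o(n (log n)^{-2/p})`.
lemma hasUpperRate_exp_rpow {p : ℝ} (hp : 0 < p) :
    HasUpperRate (fun θ => Real.exp (θ ^ (-p))) (fun n => n * Real.log n ^ (-2 / p)) := by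
  intro C δ hC hδ hδ'
  refine ⟨2 * C + 9 * (1 / 2) ^ (-2 / p), 3 + C * Real.exp (δ ^ (-p)), ?_⟩
  filter_upwards [eventually_log_scale_mem_Ioc hp one_half_pos (u := min δ (1 / 4)) (by positivity),
    eventually_gt_atTop 1, eventually_sqrt_le_mul_log_rpow p] with n hη hn hsqrt h hh hgh
  have hn' : (1 : ℝ) < n := Nat.one_lt_cast.2 hn
  have hsq := mul_sq_log_scale (p := p) one_half_pos hn'
  have hval := exp_log_scale_rpow_neg hp.ne' one_half_pos hn'
  set η := (1 / 2 * Real.log (n : ℝ)) ^ (-p⁻¹)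
  have hηδ : η ≤ δ := hη.2.trans (min_le_left _ _)
  have hη4 : η ≤ 1 / 4 := hη.2.trans (min_le_right _ _)
  have hanti : AntitoneOn (fun θ : ℝ => Real.exp (θ ^ (-p))) (Set.Icc η δ) :=
    fun x hx y _ hxy => Real.exp_le_exp.2
      (Real.rpow_le_rpow_of_nonpos (hη.1.trans_le hx.1) hxy (neg_nonpos.2 hp.le))
  have hIntegrable : IntervalIntegrable (fun θ : ℝ => Real.exp (θ ^ (-p))) volume η δ :=
    AntitoneOn.intervalIntegrable (by rwa [Set.uIcc_of_le hηδ])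
  have hmean : ∫ θ in η..δ, Real.exp (θ ^ (-p)) ≤ (δ - η) * (n : ℝ) ^ (1 / 2 : ℝ) := by
    rw [← hval, ← smul_eq_mul, ← intervalIntegral.integral_const]
    exact intervalIntegral.integral_mono_on hηδ hIntegrable (by simp)
      fun θ hθ => hanti ⟨le_rfl, hηδ⟩ hθ hθ.1
  have hupp := hh.neg_log_szegoError_le_of_le hδ' hgh n hη.1 hη4 hηδ hIntegrable
  rw [hval, hsq] at hupp
  have hsum : η * (n : ℝ) ^ (1 / 2 : ℝ) + ∫ θ in η..δ, Real.exp (θ ^ (-p)) ≤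
      n * Real.log n ^ (-2 / p) :=
    calc _ ≤ δ * (n : ℝ) ^ (1 / 2 : ℝ) := by linarith
      _ ≤ 1 * (n : ℝ) ^ (1 / 2 : ℝ) := by gcongr; linarith
      _ ≤ _ := by rwa [one_mul]
  have hCsum := mul_le_mul_of_nonneg_left hsum hC.le
  have hrate : 0 ≤ C * (n * Real.log n ^ (-2 / p)) :=
    mul_nonneg hC.le ((Real.rpow_nonneg (Nat.cast_nonneg n) _).trans hsqrt)
  linarith

lemma hasDeepZeroRate_exp_rpow {p : ℝ} (hp : 0 < p) :
    HasDeepZeroRate (fun θ => Real.exp (θ ^ (-p))) (fun n => n * Real.log n ^ (-2 / p)) :=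
  (hasLowerRate_exp_rpow hp).hasDeepZeroRate (hasUpperRate_exp_rpow hp)
    (fun _ _ => Real.exp_pos _)
    (fun _ _ => mul_pos (by positivity)
      (Real.rpow_pos_of_pos (Real.log_pos (Nat.one_lt_cast.2 (by lia))) _))
    (tendsto_mul_log_rpow_atTop p)

/-! ### Profiles growing like `θ⁻¹ log ^ p (1 / θ)` -/

lemma rpow_le_pow_mul_rpow {p : ℝ} {m : ℕ} (hm : |p| ≤ m) {x y M : ℝ} (hx : 0 < x) (hy : 0 < y)
    (hM : 1 ≤ M) (hxy : x ≤ M * y) (hyx : y ≤ M * x) : x ^ p ≤ M ^ m * y ^ p := by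
  have hratio : (x / y) ^ p ≤ M ^ |p| := by
    rcases le_total 0 p with hp | hp
    · rw [abs_of_nonneg hp]
      exact Real.rpow_le_rpow (by positivity) ((div_le_iff₀ hy).2 hxy) hp
    · rw [abs_of_nonpos hp, ← inv_div, Real.inv_rpow (by positivity),
        ← Real.rpow_neg (by positivity)]
      exact Real.rpow_le_rpow (by positivity) ((div_le_iff₀ hx).2 hyx) (neg_nonneg.2 hp)
  calc x ^ p = (x / y) ^ p * y ^ p := by
        rw [← Real.mul_rpow (by positivity) hy.le, div_mul_cancel₀ x hy.ne']
    _ ≤ M ^ |p| * y ^ p := by gcongr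
    _ ≤ M ^ m * y ^ p := by
        rw [← Real.rpow_natCast M m]
        gcongr

lemma natCast_rpow_le_dist {p : ℝ} {m : ℕ} (hm : |p| ≤ m) {k j : ℕ} (hk : 0 < k) (hj : 0 < j) :
    (k : ℝ) ^ p ≤ (1 + (Nat.dist k j : ℝ)) ^ m * (j : ℝ) ^ p := by
  have hle : ∀ {a b : ℕ}, 0 < b → a ≤ b + Nat.dist k j → (a : ℝ) ≤ (1 + Nat.dist k j) * b := by
    intro a b hb hab
    have hmul : Nat.dist k j ≤ Nat.dist k j * b := Nat.le_mul_of_pos_right _ hb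
    exact_mod_cast (by linarith : a ≤ (1 + Nat.dist k j) * b)
  refine rpow_le_pow_mul_rpow hm (by positivity) (by positivity) (by simp) (hle hj ?_) (hle hk ?_)
  all_goals unfold Nat.dist; lia

lemma sum_dist_le_two_mul_tsum {u : ℕ → ℝ} (hu : Summable u) (hu0 : ∀ i, 0 ≤ u i) (s : Finset ℕ)
    (j : ℕ) : ∑ k ∈ s, u (Nat.dist k j) ≤ 2 * ∑' i, u i := by
  have hinj : ∀ t : Finset ℕ, Set.InjOn (fun k => Nat.dist k j) t →
      ∑ k ∈ t, u (Nat.dist k j) ≤ ∑' i, u i := fun t ht => by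
    rw [← Finset.sum_image (f := u) ht]
    exact hu.sum_le_tsum _ fun i _ => hu0 i
  rw [← Finset.sum_filter_add_sum_filter_not s (· ≤ j), two_mul]
  refine add_le_add (hinj _ fun a ha b hb hab => ?_) (hinj _ fun a ha b hb hab => ?_)
  all_goals
    simp only [Finset.coe_filter, Set.mem_ofPred_eq, Nat.dist] at ha hb hab
    lia

lemma summable_one_add_pow_mul_geometric (m : ℕ) :
    Summable fun i : ℕ => (1 + (i : ℝ)) ^ m * (1 / 2) ^ i := by
  have hsum := summable_pow_mul_geometric_of_norm_lt_one (R := ℝ) m (r := 1 / 2) (by norm_num)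
  refine (((summable_nat_add_iff 1).2 hsum).mul_left 2).congr fun i => ?_
  push_cast
  ring

lemma min_two_pow_le {j : ℕ} {θ : ℝ} (hθ : 0 < θ) (hj : θ⁻¹ ≤ 2 ^ (j + 1)) (k : ℕ) :
    min ((2 : ℝ) ^ k) (1 / (4 * 2 ^ k * θ ^ 2)) ≤ 2 ^ j * (1 / 2) ^ Nat.dist k j := by
  rcases le_total k j with hkj | hjk
  · refine (min_le_left _ _).trans_eq ?_
    rw [Nat.dist_eq_sub_of_le hkj, one_div, inv_pow, ← div_eq_mul_inv, eq_div_iff (by positivity),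
      ← pow_add, Nat.add_sub_cancel' hkj]
  · refine (min_le_right _ _).trans ?_
    obtain ⟨i, rfl⟩ := Nat.exists_eq_add_of_le hjk
    rw [Nat.dist_eq_sub_of_le_right hjk, Nat.add_sub_cancel_left]
    calc 1 / (4 * 2 ^ (j + i) * θ ^ 2) = θ⁻¹ ^ 2 / (4 * 2 ^ (j + i)) := by field_simp
      _ ≤ (2 ^ (j + 1)) ^ 2 / (4 * 2 ^ (j + i)) := by gcongr
      _ = 2 ^ j * (1 / 2) ^ i := by rw [one_div, inv_pow]; field_simp; ring

lemma sum_rpow_mul_min_le {p : ℝ} {m : ℕ} (hm : |p| ≤ m) {j : ℕ} (hj0 : 0 < j) {θ : ℝ}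
    (hθ : 0 < θ) (hj : θ⁻¹ ≤ 2 ^ (j + 1)) (K : ℕ) :
    ∑ k ∈ Finset.Icc 1 K, (k : ℝ) ^ p * min ((2 : ℝ) ^ k) (1 / (4 * 2 ^ k * θ ^ 2)) ≤
      2 ^ j * (j : ℝ) ^ p * (2 * ∑' i : ℕ, (1 + (i : ℝ)) ^ m * (1 / 2) ^ i) := by
  set u : ℕ → ℝ := fun i => (1 + (i : ℝ)) ^ m * (1 / 2) ^ i
  have hterm : ∀ k ∈ Finset.Icc 1 K,
      (k : ℝ) ^ p * min ((2 : ℝ) ^ k) (1 / (4 * 2 ^ k * θ ^ 2)) ≤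
        2 ^ j * (j : ℝ) ^ p * u (Nat.dist k j) := fun k hk =>
    calc (k : ℝ) ^ p * min ((2 : ℝ) ^ k) (1 / (4 * 2 ^ k * θ ^ 2))
        ≤ ((1 + (Nat.dist k j : ℝ)) ^ m * (j : ℝ) ^ p) * (2 ^ j * (1 / 2) ^ Nat.dist k j) :=
          mul_le_mul (natCast_rpow_le_dist hm (Finset.mem_Icc.1 hk).1 hj0)
            (min_two_pow_le hθ hj k) (by positivity) (by positivity)
      _ = 2 ^ j * (j : ℝ) ^ p * u (Nat.dist k j) := by ring
  refine (Finset.sum_le_sum hterm).trans ?_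
  rw [← Finset.mul_sum]
  gcongr
  exact sum_dist_le_two_mul_tsum (summable_one_add_pow_mul_geometric m)
    (fun i => by positivity) _ j

lemma log_one_div_pos {θ : ℝ} (hθ : θ ∈ Set.Ioc (0 : ℝ) (1 / 2)) : 0 < Real.log (1 / θ) :=
  Real.log_pos (by rw [lt_div_iff₀ hθ.1]; linarith [hθ.2])

lemma exists_pos_two_pow_near {θ : ℝ} (hθ : θ ∈ Set.Ioc (0 : ℝ) (1 / 2)) :
    ∃ j : ℕ, 0 < j ∧ 2 ^ j ≤ θ⁻¹ ∧ θ⁻¹ ≤ 2 ^ (j + 1) := by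
  have htwo : 2 ≤ θ⁻¹ := (le_inv_comm₀ two_pos hθ.1).2 (by linarith [hθ.2])
  obtain ⟨j, hj, hj'⟩ := exists_nat_pow_near (one_le_two.trans htwo) one_lt_two
  refine ⟨j, Nat.pos_of_ne_zero ?_, hj, hj'.le⟩
  rintro rfl
  linarith

lemma natCast_rpow_le_log_rpow {p : ℝ} {m : ℕ} (hm : |p| ≤ m) {j : ℕ} (hj0 : 0 < j) {x : ℝ}
    (hj : 2 ^ j ≤ x) (hj' : x ≤ 2 ^ (j + 1)) : (j : ℝ) ^ p ≤ 2 ^ m * Real.log x ^ p := by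
  have hjR : (1 : ℝ) ≤ j := Nat.one_le_cast.2 hj0
  have hlower : j * Real.log 2 ≤ Real.log x := by
    rw [← Real.log_pow]
    exact Real.log_le_log (by positivity) hj
  have hupper : Real.log x ≤ (j + 1) * Real.log 2 := by
    have hlog := Real.log_le_log ((by positivity : (0 : ℝ) < 2 ^ j).trans_le hj) hj'
    rwa [Real.log_pow, Nat.cast_succ] at hlog
  have htwo : 0.69 < Real.log 2 := by linarith [Real.log_two_gt_d9]
  have htwo' : Real.log 2 < 0.7 := by linarith [Real.log_two_lt_d9]
  exact rpow_le_pow_mul_rpow hm (by positivity) (by nlinarith) one_le_two (by nlinarith)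
    (by nlinarith)

lemma exists_sum_rpow_mul_min_le (p : ℝ) : ∃ A : ℝ, 0 < A ∧ ∀ θ ∈ Set.Ioc (0 : ℝ) (1 / 2), ∀ K : ℕ,
    ∑ k ∈ Finset.Icc 1 K, (k : ℝ) ^ p * min ((2 : ℝ) ^ k) (1 / (4 * 2 ^ k * θ ^ 2)) ≤
      A * (θ⁻¹ * Real.log (1 / θ) ^ p) := by
  obtain ⟨m, hm⟩ := exists_nat_ge |p|
  set S := ∑' i : ℕ, (1 + (i : ℝ)) ^ m * (1 / 2) ^ i
  have hS : 0 < S := (summable_one_add_pow_mul_geometric m).tsum_pos (fun i => by positivity) 0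
    (by simp)
  refine ⟨2 ^ m * (2 * S), by positivity, fun θ hθ K => ?_⟩
  have hlog : 0 < Real.log (1 / θ) := log_one_div_pos hθ
  obtain ⟨j, hj0, hj, hj'⟩ := exists_pos_two_pow_near hθ
  rw [one_div] at hlog ⊢
  calc _ ≤ 2 ^ j * (j : ℝ) ^ p * (2 * S) := sum_rpow_mul_min_le hm hj0 hθ.1 hj' K
    _ ≤ θ⁻¹ * (2 ^ m * Real.log θ⁻¹ ^ p) * (2 * S) := by
        have hinv : 0 ≤ θ⁻¹ := inv_nonneg.2 hθ.1.le
        gcongr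
        exact natCast_rpow_le_log_rpow hm hj0 hj hj'
    _ = 2 ^ m * (2 * S) * (θ⁻¹ * Real.log θ⁻¹ ^ p) := by ring

-- Cauchy-Schwarz for the factorization `k ^ p * 2 ^ k = (k ^ p * 2 ^ (-k / 2)) * 8 ^ (k / 2)`.
lemma exists_sum_rpow_mul_two_pow_sq_le (p : ℝ) : ∃ B : ℝ, ∀ K : ℕ,
    (∑ k ∈ Finset.Icc 1 K, (k : ℝ) ^ p * 2 ^ k) ^ 2 ≤ B * ((8 ^ K : ℕ) : ℝ) := by
  obtain ⟨m, hm⟩ := exists_nat_ge p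
  have hsum := summable_pow_mul_geometric_of_norm_lt_one (R := ℝ) (2 * m) (r := 1 / 2)
    (by norm_num)
  set S := ∑' i : ℕ, (i : ℝ) ^ (2 * m) * (1 / 2) ^ i
  have hfirst : ∀ K : ℕ, ∑ k ∈ Finset.Icc 1 K, ((k : ℝ) ^ p) ^ 2 * (1 / 2) ^ k ≤ S := fun K => by
    refine le_trans (Finset.sum_le_sum fun k hk => ?_)
      (hsum.sum_le_tsum (Finset.Icc 1 K) fun i _ => by positivity)
    have hk1 : (1 : ℝ) ≤ k := Nat.one_le_cast.2 (Finset.mem_Icc.1 hk).1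
    rw [mul_comm 2 m, pow_mul, ← Real.rpow_natCast (k : ℝ) m]
    gcongr
  have hsecond : ∀ K : ℕ, ∑ k ∈ Finset.Icc 1 K, (8 : ℝ) ^ k ≤ 8 * (8 ^ K : ℕ) := fun K => by
    rw [← Nat.cast_ofNat (R := ℝ) (n := 8), ← Nat.cast_mul, ← pow_succ']
    exact_mod_cast (Nat.geomSum_lt (by norm_num)
      fun k hk => Nat.lt_succ_of_le (Finset.mem_Icc.1 hk).2).le
  refine ⟨S * 8, fun K => ?_⟩
  calc (∑ k ∈ Finset.Icc 1 K, (k : ℝ) ^ p * 2 ^ k) ^ 2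
      ≤ (∑ k ∈ Finset.Icc 1 K, ((k : ℝ) ^ p) ^ 2 * (1 / 2) ^ k) * ∑ k ∈ Finset.Icc 1 K, 8 ^ k := by
        refine Finset.sum_sq_le_sum_mul_sum_of_sq_le_mul _ (fun k _ => by positivity)
          (fun k _ => by positivity) fun k _ => le_of_eq ?_
        have hfactor : ((2 : ℝ) ^ k) ^ 2 = (1 / 2) ^ k * 8 ^ k := by
          rw [← pow_mul, mul_comm, pow_mul, ← mul_pow]
          norm_num
        rw [mul_pow, hfactor, mul_assoc]
    _ ≤ S * (8 * (8 ^ K : ℕ)) :=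
        mul_le_mul (hfirst K) (hsecond K) (by positivity) (tsum_nonneg fun i => by positivity)
    _ = S * 8 * (8 ^ K : ℕ) := by ring

lemma sixteen_pow_log_div_four_le {n : ℕ} (hn : n ≠ 0) : 16 ^ (Nat.log 2 n / 4) ≤ n :=
  calc 16 ^ (Nat.log 2 n / 4) = 2 ^ (4 * (Nat.log 2 n / 4)) := by rw [pow_mul]; norm_num
    _ ≤ 2 ^ Nat.log 2 n := Nat.pow_le_pow_right two_pos (Nat.mul_div_le _ _)
    _ ≤ n := Nat.pow_log_le_self 2 hn

lemma antitoneOn_sum_rpow_mul_min (p : ℝ) (K : ℕ) :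
    AntitoneOn (fun θ : ℝ => ∑ k ∈ Finset.Icc 1 K,
      (k : ℝ) ^ p * min ((2 : ℝ) ^ k) (1 / (4 * 2 ^ k * θ ^ 2))) (Set.Ioi 0) := by
  intro x hx y _ hxy
  have hx0 : 0 < x := hx
  beta_reduce
  gcongr

lemma exists_mul_sum_rpow_mul_min_le_half_add (p : ℝ) {c δ : ℝ} (hc : 0 < c) (hδ : 0 < δ)
    (hδ' : δ ≤ 1 / 2) : ∃ ε C₁ : ℝ, 0 < ε ∧ ∀ h : ℝ → ℝ,
      (∀ θ ∈ Set.Ioc (0 : ℝ) (1 / 2), 0 ≤ h θ) →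
      (∀ θ ∈ Set.Ioc 0 δ, c * (θ⁻¹ * Real.log (1 / θ) ^ p) ≤ h θ) →
        ∀ K : ℕ, ∀ θ ∈ Set.Ioc (0 : ℝ) (1 / 2), ε * ∑ k ∈ Finset.Icc 1 K,
          (k : ℝ) ^ p * min ((2 : ℝ) ^ k) (1 / (4 * 2 ^ k * θ ^ 2)) ≤ h θ / 2 + C₁ := by
  obtain ⟨A, hA, hsum⟩ := exists_sum_rpow_mul_min_le p
  have hlog : 0 < Real.log (1 / δ) := log_one_div_pos ⟨hδ, hδ'⟩
  have hC₁ : 0 < c * (δ⁻¹ * Real.log (1 / δ) ^ p) / 2 := by positivity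
  refine ⟨c / (2 * A), c * (δ⁻¹ * Real.log (1 / δ) ^ p) / 2, by positivity,
    fun h hnonneg hlower K θ hθ => ?_⟩
  have hscaled : ∀ x ∈ Set.Ioc (0 : ℝ) (1 / 2), c / (2 * A) * ∑ k ∈ Finset.Icc 1 K,
      (k : ℝ) ^ p * min ((2 : ℝ) ^ k) (1 / (4 * 2 ^ k * x ^ 2)) ≤
        c * (x⁻¹ * Real.log (1 / x) ^ p) / 2 := fun x hx =>
    calc _ ≤ c / (2 * A) * (A * (x⁻¹ * Real.log (1 / x) ^ p)) := by gcongr; exact hsum x hx K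
      _ = _ := by field_simp
  rcases le_total θ δ with hθδ | hδθ
  · linarith [hscaled θ hθ, hlower θ ⟨hθ.1, hθδ⟩]
  · have hmono := mul_le_mul_of_nonneg_left
      (antitoneOn_sum_rpow_mul_min p K hδ hθ.1 hδθ) (by positivity : 0 ≤ c / (2 * A))
    linarith [hscaled δ ⟨hδ, hδ'⟩, hnonneg θ hθ]

lemma exists_mul_sum_rpow_sub_le_neg_log_szegoError (p : ℝ) {c δ : ℝ} (hc : 0 < c) (hδ : 0 < δ)
    (hδ' : δ ≤ 1 / 2) : ∃ ε B : ℝ, 0 < ε ∧ ∀ n : ℕ, n ≠ 0 → ∀ h : ℝ → ℝ, IsDeepProfile h →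
      (∀ θ ∈ Set.Ioc 0 δ, c * (θ⁻¹ * Real.log (1 / θ) ^ p) ≤ h θ) →
        ε * ∑ k ∈ Finset.Icc 1 (Nat.log 2 n / 4), (k : ℝ) ^ p - B ≤
          -Real.log (szegoError (deepZeroMeasure h) n) := by
  obtain ⟨ε, C₁, hε, hminor⟩ := exists_mul_sum_rpow_mul_min_le_half_add p hc hδ hδ'
  obtain ⟨C₂, hsq⟩ := exists_sum_rpow_mul_two_pow_sq_le p
  refine ⟨ε, C₁ + ε ^ 2 * C₂, hε, fun n hn h hh hlower => ?_⟩
  set K := Nat.log 2 n / 4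
  have hdeg : 8 ^ K * 2 ^ K ≤ n := by
    rw [← mul_pow]
    exact sixteen_pow_log_div_four_le hn
  have hfejer := hh.le_neg_log_szegoError_of_fejer_sum (b := fun k => ε * (k : ℝ) ^ p) (C₁ := C₁)
    (C₂ := ε ^ 2 * C₂) (by positivity) hdeg (fun k => by positivity)
    (fun θ hθ => by
      simp only [mul_assoc ε, ← Finset.mul_sum]
      exact hminor h hh.nonneg hlower K θ hθ)
    (by
      simp only [mul_assoc ε, ← Finset.mul_sum]
      rw [mul_pow, mul_assoc]
      exact mul_le_mul_of_nonneg_left (hsq K) (sq_nonneg ε))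
  rwa [← Finset.mul_sum, sub_sub] at hfejer

lemma hasLowerRate_inv_mul_log_rpow {p k B : ℝ} {r : ℕ → ℝ} (hk : 0 < k)
    (hr : ∀ᶠ n : ℕ in atTop,
      k * r n - B ≤ ∑ k ∈ Finset.Icc 1 (Nat.log 2 n / 4), (k : ℝ) ^ p) :
    HasLowerRate (fun θ => θ⁻¹ * Real.log (1 / θ) ^ p) r := by
  intro c δ hc hδ hδ'
  obtain ⟨ε, B', hε, hlow⟩ := exists_mul_sum_rpow_sub_le_neg_log_szegoError p hc hδ hδ'
  refine ⟨ε * k, ε * B + B', mul_pos hε hk, ?_⟩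
  filter_upwards [hr, eventually_ne_atTop 0] with n hrn hn h hh hgh
  have hsum := mul_le_mul_of_nonneg_left hrn hε.le
  linarith [hlow n hn h hh hgh]

lemma continuousOn_inv_mul_log_rpow (p : ℝ) :
    ContinuousOn (fun θ : ℝ => θ⁻¹ * Real.log (1 / θ) ^ p) (Set.Ioc 0 (1 / 2)) := fun _ hθ =>
  ((continuousAt_inv₀ hθ.1.ne').mul (((continuousAt_const.div continuousAt_id hθ.1.ne').log
    (one_div_pos.2 hθ.1).ne').rpow_const (Or.inl (log_one_div_pos hθ).ne'))).continuousWithinAt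

lemma integral_inv_mul_log_rpow {p : ℝ} {G : ℝ → ℝ}
    (hG : ∀ x, 0 < x → HasDerivAt G (x ^ p) x) {η δ : ℝ} (hη : η ∈ Set.Ioc (0 : ℝ) (1 / 2))
    (hδ : δ ∈ Set.Ioc (0 : ℝ) (1 / 2)) :
    IntervalIntegrable (fun θ => θ⁻¹ * Real.log (1 / θ) ^ p) volume η δ ∧
      ∫ θ in η..δ, θ⁻¹ * Real.log (1 / θ) ^ p = G (Real.log (1 / η)) - G (Real.log (1 / δ)) := by
  have hsub : Set.uIcc η δ ⊆ Set.Ioc (0 : ℝ) (1 / 2) := Set.ordConnected_Ioc.uIcc_subset hη hδ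
  have hIntegrable := ((continuousOn_inv_mul_log_rpow p).mono hsub).intervalIntegrable (μ := volume)
  refine ⟨hIntegrable, ?_⟩
  rw [← neg_sub_neg]
  refine intervalIntegral.integral_eq_sub_of_hasDerivAt
    (f := fun θ => -G (Real.log (1 / θ))) (fun θ hθ => ?_) hIntegrable
  have hlog : HasDerivAt (fun θ : ℝ => Real.log (1 / θ)) (-θ⁻¹) θ := by
    simp only [one_div, Real.log_inv]
    exact (Real.hasDerivAt_log (hsub hθ).1.ne').neg
  refine ((hG _ (log_one_div_pos (hsub hθ))).comp θ hlog).neg.congr_deriv ?_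
  ring

lemma hasUpperRate_inv_mul_log_rpow {p K B : ℝ} {G : ℝ → ℝ} {r : ℕ → ℝ}
    (hG : ∀ x, 0 < x → HasDerivAt G (x ^ p) x)
    (hpow : ∀ᶠ n : ℕ in atTop, (Real.log n / 2) ^ p ≤ K * r n + B)
    (hGr : ∀ᶠ n : ℕ in atTop, G (Real.log n / 2) ≤ K * r n + B) :
    HasUpperRate (fun θ => θ⁻¹ * Real.log (1 / θ) ^ p) r := by
  intro C δ hC hδ hδ'
  refine ⟨2 * C * K, 12 + 2 * C * B - C * G (Real.log (1 / δ)) +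
    C * (δ⁻¹ * Real.log (1 / δ) ^ p), ?_⟩
  filter_upwards [hpow, hGr, eventually_div_rpow_mem_Ioc (p := 1) (by norm_num) one_pos
    (u := min δ (1 / 4)) (by positivity), eventually_gt_atTop 0] with n hpow hGr hη hn h hh hgh
  have hn' : (0 : ℝ) < n := Nat.cast_pos.2 hn
  have hsq := mul_sq_div_rpow (p := 1) (by norm_num) one_pos hn'
  have hlog : Real.log (1 / (1 / (n : ℝ)) ^ (1 + 1 : ℝ)⁻¹) = Real.log n / 2 := by
    rw [one_div, Real.log_inv, Real.log_rpow (by positivity), one_div, Real.log_inv]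
    ring
  set η := (1 / (n : ℝ)) ^ (1 + 1 : ℝ)⁻¹
  have hη4 : η ≤ 1 / 4 := hη.2.trans (min_le_right _ _)
  obtain ⟨hIntegrable, hmean⟩ := integral_inv_mul_log_rpow hG ⟨hη.1, by linarith⟩ ⟨hδ, hδ'⟩
  have hupp := hh.neg_log_szegoError_le_of_le hδ' hgh n hη.1 hη4
    (hη.2.trans (min_le_left _ _)) hIntegrable
  rw [hmean, hsq, mul_inv_cancel_left₀ hη.1.ne', hlog, sub_self, zero_div, Real.rpow_zero,
    Real.one_rpow] at hupp
  linarith [mul_le_mul_of_nonneg_left hpow hC.le, mul_le_mul_of_nonneg_left hGr hC.le]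

lemma log_le_four_mul_log_div_four_add_one {n : ℕ} (hn : 0 < n) :
    Real.log n ≤ 4 * ((Nat.log 2 n / 4 : ℕ) + 1) := by
  have hlt : n < 2 ^ (4 * (Nat.log 2 n / 4 + 1)) :=
    (Nat.lt_pow_succ_log_self one_lt_two n).trans_le (Nat.pow_le_pow_right two_pos (by lia))
  have hlog := Real.log_le_log (Nat.cast_pos.2 hn) (Nat.cast_le (α := ℝ).2 hlt.le)
  rw [Nat.cast_pow, Real.log_pow] at hlog
  push_cast at hlog
  refine hlog.trans (mul_le_of_le_one_right (by positivity) ?_)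
  linarith [Real.log_two_lt_d9]

lemma rpow_add_one_le_sum_rpow {p : ℝ} (hp : -1 < p) (hp' : p ≤ 0) (K : ℕ) :
    (K : ℝ) ^ (p + 1) ≤ ∑ k ∈ Finset.Icc 1 K, (k : ℝ) ^ p := by
  rcases K.eq_zero_or_pos with rfl | hK
  · simp [Real.zero_rpow (by linarith : p + 1 ≠ 0)]
  · have hK' : (0 : ℝ) < K := Nat.cast_pos.2 hK
    calc (K : ℝ) ^ (p + 1) = ∑ _k ∈ Finset.Icc 1 K, (K : ℝ) ^ p := by
          rw [Finset.sum_const, Nat.card_Icc, nsmul_eq_mul, Nat.add_sub_cancel,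
            Real.rpow_add_one' hK'.le (by linarith), mul_comm]
      _ ≤ ∑ k ∈ Finset.Icc 1 K, (k : ℝ) ^ p := Finset.sum_le_sum fun k hk =>
          Real.rpow_le_rpow_of_nonpos (Nat.cast_pos.2 (Finset.mem_Icc.1 hk).1)
            (Nat.cast_le.2 (Finset.mem_Icc.1 hk).2) hp'

lemma rpow_add_one_sub_rpow_add_one_le {p x : ℝ} (hp : 0 ≤ p) (hx : 1 ≤ x) :
    x ^ (p + 1) - (x - 1) ^ (p + 1) ≤ (p + 1) * x ^ p := by
  have hx0 : 0 < x := one_pos.trans_le hx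
  have hbernoulli : 1 + (p + 1) * -x⁻¹ ≤ (1 + -x⁻¹) ^ (p + 1) :=
    one_add_mul_self_le_rpow_one_add (neg_le_neg (inv_le_one_of_one_le₀ hx)) (by linarith)
  have hscale : x ^ (p + 1) * (1 + -x⁻¹) ^ (p + 1) = (x - 1) ^ (p + 1) := by
    rw [← Real.mul_rpow hx0.le (by linarith [inv_le_one_of_one_le₀ hx]), mul_add, mul_one, mul_neg,
      mul_inv_cancel₀ hx0.ne', sub_eq_add_neg]
  have hmul := mul_le_mul_of_nonneg_left hbernoulli (Real.rpow_nonneg hx0.le (p + 1))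
  rw [hscale] at hmul
  have hpow : x ^ (p + 1) * x⁻¹ = x ^ p := by
    rw [Real.rpow_add_one hx0.ne', mul_inv_cancel_right₀ hx0.ne']
  linear_combination hmul + (p + 1) * hpow

lemma rpow_add_one_le_mul_sum_rpow {p : ℝ} (hp : 0 ≤ p) (K : ℕ) :
    (K : ℝ) ^ (p + 1) ≤ (p + 1) * ∑ k ∈ Finset.Icc 1 K, (k : ℝ) ^ p := by
  induction K with
  | zero => simp [Real.zero_rpow (by linarith : p + 1 ≠ 0)]
  | succ K ih =>
    have hstep := rpow_add_one_sub_rpow_add_one_le hp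
      (by simp : (1 : ℝ) ≤ (K + 1 : ℕ))
    rw [Nat.cast_succ, add_sub_cancel_right] at hstep
    rw [Finset.sum_Icc_succ_top (by lia), mul_add, Nat.cast_succ]
    linarith

lemma rpow_add_one_le_max_mul_sum_rpow {p : ℝ} (hp : -1 < p) (K : ℕ) :
    (K : ℝ) ^ (p + 1) ≤ max 1 (p + 1) * ∑ k ∈ Finset.Icc 1 K, (k : ℝ) ^ p := by
  rcases le_total p 0 with hp' | hp'
  · rw [max_eq_left (by linarith), one_mul]
    exact rpow_add_one_le_sum_rpow hp hp' K
  · rw [max_eq_right (by linarith)]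
    exact rpow_add_one_le_mul_sum_rpow hp' K

lemma one_lt_log_of_four_le {n : ℕ} (hn : 4 ≤ n) : 1 < Real.log n := by
  rw [Real.lt_log_iff_exp_lt (by positivity)]
  have hn' : (4 : ℝ) ≤ n := Nat.ofNat_le_cast.2 hn
  linarith [Real.exp_one_lt_d9]

lemma hasLowerRate_log_rpow {p : ℝ} (hp : -1 < p) :
    HasLowerRate (fun θ => θ⁻¹ * Real.log (1 / θ) ^ p) (fun n => Real.log n ^ (p + 1)) := by
  refine hasLowerRate_inv_mul_log_rpow (k := (max 1 (p + 1))⁻¹ * (1 / 8) ^ (p + 1)) (B := 0)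
    (by positivity) ?_
  filter_upwards [eventually_ge_atTop 16] with n hn
  have hlog := one_lt_log_of_four_le (by lia : 4 ≤ n)
  have hscales : 1 ≤ Nat.log 2 n / 4 :=
    (Nat.one_le_div_iff four_pos).2 (Nat.le_log_of_pow_le one_lt_two hn)
  have hscales' : (1 : ℝ) ≤ (Nat.log 2 n / 4 : ℕ) := Nat.one_le_cast.2 hscales
  rw [sub_zero, mul_assoc, inv_mul_le_iff₀ (by positivity),
    ← Real.mul_rpow (by positivity) (by linarith)]
  refine le_trans ?_ (rpow_add_one_le_max_mul_sum_rpow hp _)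
  exact Real.rpow_le_rpow (by linarith)
    (by linarith [log_le_four_mul_log_div_four_add_one (by lia : 0 < n)]) (by linarith)

lemma hasUpperRate_log_rpow {p : ℝ} (hp : -1 < p) :
    HasUpperRate (fun θ => θ⁻¹ * Real.log (1 / θ) ^ p) (fun n => Real.log n ^ (p + 1)) := by
  have hp1 : 0 < p + 1 := by linarith
  refine hasUpperRate_inv_mul_log_rpow (G := fun x => x ^ (p + 1) / (p + 1))
    (K := max 1 (p + 1)⁻¹) (B := 0) (fun x hx => ?_) ?_ ?_
  · refine ((Real.hasDerivAt_rpow_const (Or.inl hx.ne')).div_const (p + 1)).congr_deriv ?_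
    rw [add_sub_cancel_right, mul_div_cancel_left₀ _ hp1.ne']
  all_goals filter_upwards [tendsto_log_natCast_atTop.eventually_ge_atTop 2] with n hlog
  all_goals
    have hhalf : (Real.log n / 2) ^ (p + 1) ≤ Real.log n ^ (p + 1) :=
      Real.rpow_le_rpow (by linarith) (by linarith) hp1.le
    have hnonneg : 0 ≤ (Real.log n / 2) ^ (p + 1) := Real.rpow_nonneg (by linarith) _
    rw [add_zero]
  · have hraise : (Real.log n / 2) ^ p ≤ (Real.log n / 2) ^ (p + 1) :=
      Real.rpow_le_rpow_of_exponent_le (by linarith) (by linarith)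
    exact (hraise.trans hhalf).trans
      (le_mul_of_one_le_left (hnonneg.trans hhalf) (le_max_left _ _))
  · rw [div_eq_inv_mul]
    exact mul_le_mul (le_max_right _ _) hhalf hnonneg (by positivity)

lemma hasDeepZeroRate_log_rpow {p : ℝ} (hp : -1 < p) :
    HasDeepZeroRate (fun θ => θ⁻¹ * Real.log (1 / θ) ^ p) (fun n => Real.log n ^ (p + 1)) :=
  (hasLowerRate_log_rpow hp).hasDeepZeroRate (hasUpperRate_log_rpow hp)
    (fun _ hθ => mul_pos (inv_pos.2 hθ.1) (Real.rpow_pos_of_pos (log_one_div_pos hθ) _))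
    (fun _ hn => Real.rpow_pos_of_pos (one_pos.trans (one_lt_log_of_four_le hn)) _)
    ((tendsto_rpow_atTop (by linarith)).comp tendsto_log_natCast_atTop)

lemma hasLowerRate_log_log :
    HasLowerRate (fun θ => θ⁻¹ * Real.log (1 / θ) ^ (-1 : ℝ))
      (fun n => Real.log (Real.log n)) := by
  refine hasLowerRate_inv_mul_log_rpow (k := 1) (B := Real.log 4) one_pos ?_
  filter_upwards [eventually_ge_atTop 4] with n hn
  have hloglog := Real.log_le_log (one_pos.trans (one_lt_log_of_four_le hn))
    (log_le_four_mul_log_div_four_add_one (by lia : 0 < n))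
  rw [Real.log_mul (by norm_num) (by positivity)] at hloglog
  have hharmonic := log_add_one_le_harmonic (Nat.log 2 n / 4)
  rw [harmonic_eq_sum_Icc] at hharmonic
  push_cast at hharmonic
  simp only [Real.rpow_neg_one]
  linarith

lemma hasUpperRate_log_log :
    HasUpperRate (fun θ => θ⁻¹ * Real.log (1 / θ) ^ (-1 : ℝ))
      (fun n => Real.log (Real.log n)) := by
  refine hasUpperRate_inv_mul_log_rpow (G := Real.log) (K := 1) (B := 1) (fun x hx => ?_) ?_ ?_
  · rw [Real.rpow_neg_one]
    exact Real.hasDerivAt_log hx.ne'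
  all_goals filter_upwards [tendsto_log_natCast_atTop.eventually_ge_atTop 2] with n hlog
  · rw [Real.rpow_neg_one]
    have hinv : (Real.log n / 2)⁻¹ ≤ 1 := inv_le_one_of_one_le₀ (by linarith)
    linarith [Real.log_nonneg (by linarith : 1 ≤ Real.log n)]
  · have hhalf : Real.log (Real.log n / 2) ≤ Real.log (Real.log n) :=
      Real.log_le_log (by linarith) (by linarith)
    linarith

lemma hasDeepZeroRate_log_log :
    HasDeepZeroRate (fun θ => 1 / (θ * Real.log (1 / θ))) (fun n => Real.log (Real.log n)) := by
  have hprofile : (fun θ : ℝ => 1 / (θ * Real.log (1 / θ))) =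
      fun θ => θ⁻¹ * Real.log (1 / θ) ^ (-1 : ℝ) :=
    funext fun θ => by rw [Real.rpow_neg_one, one_div, mul_inv]
  rw [hprofile]
  exact hasLowerRate_log_log.hasDeepZeroRate hasUpperRate_log_log
    (fun _ hθ => mul_pos (inv_pos.2 hθ.1) (Real.rpow_pos_of_pos (log_one_div_pos hθ) _))
    (fun _ hn => Real.log_pos (one_lt_log_of_four_le hn))
    (Real.tendsto_log_atTop.comp tendsto_log_natCast_atTop)

theorem mainTheorem10 :
    HasDeepZeroRate (fun θ => 1 / (θ * Real.log (1 / θ)))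
      (fun n => Real.log (Real.log (n : ℝ))) ∧
    (∀ p : ℝ, -1 < p →
      HasDeepZeroRate (fun θ => θ⁻¹ * Real.log (1 / θ) ^ p)
        (fun n => Real.log (n : ℝ) ^ (p + 1))) ∧
    (∀ p : ℝ, 1 < p →
      HasDeepZeroRate (fun θ => θ ^ (-p))
        (fun n => (n : ℝ) ^ ((p - 1) / (p + 1)))) ∧
    (∀ p : ℝ, 0 < p →
      HasDeepZeroRate (fun θ => Real.exp (θ ^ (-p)))
        (fun n => (n : ℝ) * Real.log (n : ℝ) ^ (-2 / p))) :=
  ⟨hasDeepZeroRate_log_log, fun _ hp => hasDeepZeroRate_log_rpow hp,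
    fun _ hp => hasDeepZeroRate_rpow hp, fun _ hp => hasDeepZeroRate_exp_rpow hp⟩
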